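/- Let $N\ge 1$ be an integer and $1<p<\infty$. Let $a_1,\dots,a_N:\mathbb Z^N\to\mathbb C$ and $\Phi:\mathbb Z^N\to\mathbb R$ be bounded functions that are slowly oscillating at infinity, i.e. $\lim_{x\to\infty}(f(x+y)-f(x))=0$ for every $y\in\mathbb Z^N$ and each $f\in\{a_1,\dots,a_N,\Phi\}$, and assume $\lim_{x\to\infty}|a_k(x)|=1$ for $k=1,\dots,N$. Consider the discrete magnetic Schrödinger operator $$H=\sum_{k=1}^N (V_{e_k}-a_kI)(V_{-e_k}-\bar a_kI)+\Phi I$$ on $l^p(\mathbb Z^N)$, where $(V_gu)(x)=u(x-g)$ and $e_1,\dots,e_N$ is the standard basis of $\mathbb Z^N$. Let $sp_{ess}(H)$ be the set of all $\lambda\in\mathbb C$ for which $H-\lambda I$ is not Fredholm. For a sequence $g:\mathbb N\to\mathbb Z^N$ tending to infinity, the limit operator $H_g$ is the bounded operator (if it exists) such that $V_{-g(j)}HV_{g(j)}\to H_g$ strongly and the adjoints of these operators converge strongly to $H_g^*$; put $\Phi^g=\lim_{j\to\infty}\Phi(g(j))$. Then: 1. $sp_{ess}(H)=\bigcup_g\,[\Phi^g,\Phi^g+4N]$,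 where the union is over all sequences $g\to\infty$ for which the limit operator $H_g$ exists. 2. If $N\ge 2$, then $sp_{ess}(H)=\bigl[\liminf_{x\to\infty}\Phi(x),\ \limsup_{x\to\infty}\Phi(x)+4N\bigr]$. 3. If $N=1$, then $$sp_{ess}(H)=\Bigl[\liminf_{x\to-\infty}\Phi(x),\ \limsup_{x\to-\infty}\Phi(x)+4\Bigr]\cup\Bigl[\liminf_{x\to+\infty}\Phi(x),\ \limsup_{x\to+\infty}\Phi(x)+4\Bigr].$$ 4. The essential spectrum does not depend on the magnetic potential: if $b_1,\dots,b_N$ are bounded slowly oscillating functions with $\lim_{x\to\infty}|b_k(x)|=1$ for each $k$, then replacing $a$ by $b$ in $H$ does not change $sp_{ess}(H)$. -/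

import Mathlib

open Filter Topology
open scoped ENNReal lp

noncomputable section

namespace DiscreteSchrodinger

/-- The lattice `ℤ^N`; `x → ∞` in it is expressed by the filter `cofinite`. -/
abbrev Lattice (N : ℕ) : Type := Fin N → ℤ

/-- The space `l^p(ℤ^N)` of complex-valued functions. -/
abbrev Ell (N : ℕ) (p : ℝ≥0∞) := ℓ^p(Lattice N, ℂ)

theorem memℓp_shift {N : ℕ} {p : ℝ≥0∞} (g : Lattice N) {u : Lattice N → ℂ} (hu : Memℓp u p) :
    Memℓp (fun x => u (x - g)) p := by
  obtain (rfl | rfl | hp) := p.trichotomy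
  · rw [memℓp_zero_iff] at hu ⊢
    exact hu.preimage (sub_left_injective.injOn)
  · rw [memℓp_infty_iff] at hu ⊢
    refine hu.mono ?_
    rintro _ ⟨x, rfl⟩
    exact ⟨x - g, rfl⟩
  · rw [memℓp_gen_iff hp] at hu ⊢
    exact (Equiv.subRight g).summable_iff.2 hu

theorem norm_shift {N : ℕ} {p : ℝ≥0∞} [Fact (1 ≤ p)] (g : Lattice N) (u : Ell N p) :
    ‖(⟨fun x => u (x - g), memℓp_shift g (lp.memℓp u)⟩ : Ell N p)‖ = ‖u‖ := by
  obtain (rfl | hp) := p.dichotomy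
  · rw [lp.norm_eq_ciSup, lp.norm_eq_ciSup]
    exact (Equiv.subRight g).iSup_comp (g := fun x => ‖u x‖)
  · have hp' : 0 < p.toReal := by linarith
    rw [lp.norm_eq_tsum_rpow hp', lp.norm_eq_tsum_rpow hp']
    congr 1
    exact (Equiv.subRight g).tsum_eq (fun x => ‖u x‖ ^ p.toReal)

/-- The shift operator `(V_g u)(x) = u(x - g)` on `l^p(ℤ^N)`. -/
def shift {N : ℕ} (p : ℝ≥0∞) [Fact (1 ≤ p)] (g : Lattice N) : Ell N p →L[ℂ] Ell N p :=
  LinearMap.mkContinuous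
    { toFun := fun u => ⟨fun x => u (x - g), memℓp_shift g (lp.memℓp u)⟩
      map_add' := fun _ _ => rfl
      map_smul' := fun _ _ => rfl }
    1 (fun u => by rw [one_mul]; exact (norm_shift g u).le)

@[simp]
theorem shift_apply {N : ℕ} (p : ℝ≥0∞) [Fact (1 ≤ p)] (g : Lattice N) (u : Ell N p)
    (x : Lattice N) : shift p g u x = u (x - g) := rfl

/-- The operator `f I` of multiplication by a bounded function `f` on `l^p(ℤ^N)`. -/
def mulOp {N : ℕ} (p : ℝ≥0∞) [Fact (1 ≤ p)] (f : ℓ^∞(Lattice N, ℂ)) : Ell N p →L[ℂ] Ell N p :=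
  lp.mapCLM p (fun x => f x • ContinuousLinearMap.id ℂ ℂ) (norm_nonneg f) (fun x => by
    rw [norm_smul, ContinuousLinearMap.norm_id, mul_one]
    exact lp.norm_apply_le_norm ENNReal.top_ne_zero f x)

@[simp]
theorem mulOp_apply {N : ℕ} (p : ℝ≥0∞) [Fact (1 ≤ p)] (f : ℓ^∞(Lattice N, ℂ)) (u : Ell N p)
    (x : Lattice N) : mulOp p f u x = f x * u x := by
  simp [mulOp]

/-- A bounded real-valued function regarded as a complex-valued one. -/
def complexify {N : ℕ} (Φ : ℓ^∞(Lattice N, ℝ)) : ℓ^∞(Lattice N, ℂ) :=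
  ⟨fun x => (Φ x : ℂ), (lp.memℓp Φ).mono' (fun x => by simp)⟩

@[simp]
theorem complexify_apply {N : ℕ} (Φ : ℓ^∞(Lattice N, ℝ)) (x : Lattice N) :
    complexify Φ x = (Φ x : ℂ) := rfl

/-- The discrete magnetic Schrödinger operator
`H = ∑ₖ (V_{eₖ} - aₖ I)(V_{-eₖ} - āₖ I) + Φ I` on `l^p(ℤ^N)`. -/
def schrodinger {N : ℕ} (p : ℝ≥0∞) [Fact (1 ≤ p)] (a : Fin N → ℓ^∞(Lattice N, ℂ))
    (Φ : ℓ^∞(Lattice N, ℝ)) : Ell N p →L[ℂ] Ell N p :=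
  ∑ k : Fin N, (shift p (Pi.single k 1) - mulOp p (a k)) ∘L
      (shift p (-Pi.single k 1) - mulOp p (star (a k)))
    + mulOp p (complexify Φ)

/-- A bounded function `f` on `ℤ^N` is slowly oscillating at infinity if
`f(x + y) - f(x) → 0` as `x → ∞`, for every `y`. -/
def SlowlyOscillating {N : ℕ} {E : Type*} [NormedAddCommGroup E] (f : ℓ^∞(Lattice N, E)) : Prop :=
  ∀ y : Lattice N, Tendsto (fun x => f (x + y) - f x) cofinite (𝓝 0)

/-- The essential spectrum: all `z` such that `A - z I` is not Fredholm. -/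
def essSpectrum {X : Type*} [NormedAddCommGroup X] [NormedSpace ℂ X] (A : X →L[ℂ] X) : Set ℂ :=
  {z | ¬ (A - z • ContinuousLinearMap.id ℂ X).IsFredholm}

/-- `B` is the limit operator of `A` defined by the sequence `h → ∞`: the operators
`V_{-h(j)} A V_{h(j)}` converge strongly to `B`, and their (Banach space) adjoints converge
strongly to the adjoint of `B`. -/
structure IsLimitOperator {N : ℕ} {p : ℝ≥0∞} [Fact (1 ≤ p)] (A : Ell N p →L[ℂ] Ell N p)
    (h : ℕ → Lattice N) (B : Ell N p →L[ℂ] Ell N p) : Prop where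
  tendsto_infty : Tendsto h atTop cofinite
  strong : ∀ u : Ell N p,
    Tendsto (fun j => (shift p (-h j) ∘L A ∘L shift p (h j)) u) atTop (𝓝 (B u))
  strong_adjoint : ∀ φ : StrongDual ℂ (Ell N p),
    Tendsto (fun j => φ ∘L (shift p (-h j) ∘L A ∘L shift p (h j))) atTop (𝓝 (φ ∘L B))

end DiscreteSchrodinger

end

open Filter Topology
open scoped ENNReal lp ComplexConjugate

noncomputable section

section Quotient

variable {R : Type*} [NormedRing R] (I : Ideal R) [I.IsTwoSided]

/-- The quotient of a normed ring by a closed two-sided ideal is a normed ring. -/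
abbrev normedRingQuotient (hI : IsClosed (I : Set R)) : NormedRing (R ⧸ I) :=
  haveI : IsClosed ((Submodule.toAddSubgroup I : AddSubgroup R) : Set R) := hI
  { QuotientAddGroup.instNormedAddCommGroup (Submodule.toAddSubgroup I),
    Ideal.Quotient.ring I with
    norm_mul_le := fun x y => by
      let _ : NormedAddCommGroup (R ⧸ I) :=
        QuotientAddGroup.instNormedAddCommGroup (Submodule.toAddSubgroup I)
      have lift (x : R ⧸ I) : ∃ u : ℕ → R, (∀ n, Ideal.Quotient.mk I (u n) = x) ∧
          Tendsto (fun n => ‖u n‖) atTop (𝓝 ‖x‖) := by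
        have h (n : ℕ) := QuotientAddGroup.exists_norm_mk_lt (S := Submodule.toAddSubgroup I) x
          (Nat.one_div_pos_of_nat (α := ℝ) (n := n))
        choose u hu hu' using h
        refine ⟨u, hu, tendsto_of_tendsto_of_tendsto_of_le_of_le tendsto_const_nhds
          (by simpa using! tendsto_one_div_add_atTop_nhds_zero_nat.const_add ‖x‖)
          (fun n => ?_) (fun n => (hu' n).le)⟩
        rw [← hu n]; exact QuotientAddGroup.norm_mk_le_norm
      obtain ⟨u, hu, hu'⟩ := lift x
      obtain ⟨v, hv, hv'⟩ := lift y
      refine ge_of_tendsto (hu'.mul hv') (Eventually.of_forall fun n => ?_)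
      rw [← hu n, ← hv n, ← map_mul]
      exact (QuotientAddGroup.norm_mk_le_norm (S := Submodule.toAddSubgroup I)).trans
        (norm_mul_le _ _) }

end Quotient

section Gelfand

/-- A commuting family in a complex Banach algebra lies in a commutative subalgebra whose characters
detect invertibility. -/
theorem exists_subalgebra_forall_exists_character {A : Type*} [NormedRing A] [NormedAlgebra ℂ A]
    [CompleteSpace A] (s : Set A) (hs : ∀ x ∈ s, ∀ y ∈ s, x * y = y * x) :
    ∃ 𝒜 : Subalgebra ℂ A, s ⊆ 𝒜 ∧ ∀ x : 𝒜, ¬ IsUnit (x : A) →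
      ∃ χ : 𝒜 →ₐ[ℂ] ℂ, χ x = 0 ∧ ∀ y : 𝒜, IsUnit (y : A) → χ y ≠ 0 := by
  have hcomm := Set.centralizer_centralizer_comm_of_comm hs
  set 𝒜 : Subalgebra ℂ A := Subalgebra.centralizer ℂ (Set.centralizer s) with h𝒜
  have hclosed : IsClosed (𝒜 : Set A) := by
    rw [h𝒜, Subalgebra.coe_centralizer]
    exact Set.isClosed_centralizer _
  let _ : NormedCommRing 𝒜 :=
    { (inferInstance : NormedRing 𝒜) with
      mul_comm := fun x y => Subtype.ext (hcomm x x.2 y y.2) }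
  let _ : NormedAlgebra ℂ 𝒜 := Subalgebra.toNormedAlgebra 𝒜
  have : CompleteSpace 𝒜 := hclosed.completeSpace_coe
  have hunit (y : 𝒜) (hy : IsUnit (y : A)) : IsUnit y := by
    obtain ⟨u, hu⟩ := hy
    have hmem : (↑u⁻¹ : A) ∈ 𝒜 := by
      rw [h𝒜, Subalgebra.mem_centralizer_iff]
      intro g hg
      have h : Commute g (u : A) := by
        rw [hu]; exact (Subalgebra.mem_centralizer_iff ℂ).1 y.2 g hg
      exact h.units_inv_right
    exact ⟨⟨y, ⟨_, hmem⟩, Subtype.ext (by simp [← hu]), Subtype.ext (by simp [← hu])⟩, rfl⟩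
  refine ⟨𝒜, Set.subset_centralizer_centralizer, fun x hx => ?_⟩
  obtain ⟨χ, hχ⟩ := WeakDual.CharacterSpace.exists_apply_eq_zero (A := 𝒜) (a := x)
    (fun h => hx (h.map 𝒜.val))
  exact ⟨WeakDual.CharacterSpace.equivAlgHom χ, hχ, fun y hy =>
    ((hunit y hy).map (WeakDual.CharacterSpace.equivAlgHom χ)).ne_zero⟩

/-- A family in a complex Banach algebra commuting modulo a closed two-sided ideal lies in a
subalgebra whose characters detect invertibility modulo the ideal. -/
theorem exists_subalgebra_forall_exists_character_quotient {R : Type*} [NormedRing R]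
    [NormedAlgebra ℂ R] [CompleteSpace R] (I : Ideal R) [I.IsTwoSided]
    (hI : IsClosed (I : Set R)) (s : Set R) (hs : ∀ x ∈ s, ∀ y ∈ s, x * y - y * x ∈ I) :
    ∃ 𝒜 : Subalgebra ℂ R, s ⊆ 𝒜 ∧ ∀ x : 𝒜, ¬ IsUnit (Ideal.Quotient.mk I (x : R)) →
      ∃ χ : 𝒜 →ₐ[ℂ] ℂ, χ x = 0 ∧
        ∀ y : 𝒜, IsUnit (Ideal.Quotient.mk I (y : R)) → χ y ≠ 0 := by
  let _ : NormedRing (R ⧸ I) := normedRingQuotient I hI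
  let _ : NormedAlgebra ℂ (R ⧸ I) :=
    { (Ideal.Quotient.algebra ℂ : Algebra ℂ (R ⧸ I)) with
      norm_smul_le := fun c x => norm_smul_le (β := R ⧸ (I.restrictScalars ℂ)) c x }
  have : CompleteSpace (R ⧸ I) :=
    Submodule.Quotient.completeSpace I
  obtain ⟨𝒜, hs𝒜, h⟩ := exists_subalgebra_forall_exists_character
    (Ideal.Quotient.mk I '' s) (by
      rintro _ ⟨x, hx, rfl⟩ _ ⟨y, hy, rfl⟩
      rw [← sub_eq_zero, ← map_mul, ← map_mul, ← map_sub, Ideal.Quotient.eq_zero_iff_mem]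
      exact hs x hx y hy)
  let q : R →ₐ[ℂ] R ⧸ I := Ideal.Quotient.mkₐ ℂ I
  refine ⟨𝒜.comap q, fun x hx => hs𝒜 ⟨x, hx, rfl⟩, fun x hx => ?_⟩
  obtain ⟨χ, hχ, hχ'⟩ := h ⟨q x, x.2⟩ hx
  let q' : 𝒜.comap q →ₐ[ℂ] 𝒜 := (q.comp (𝒜.comap q).val).codRestrict 𝒜 (fun y => y.2)
  exact ⟨χ.comp q', hχ, fun y hy => hχ' (q' y) hy⟩

end Gelfand

/-- Modulo a two-sided ideal, a right inverse of an element with a left inverse is a left inverse. -/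
theorem mul_sub_one_mem_of_left_inverse {R : Type*} [Ring R] {I : Ideal R} [I.IsTwoSided]
    {T a b : R} (ha : T * a - 1 ∈ I) (hb : b * T - 1 ∈ I) : a * T - 1 ∈ I := by
  have h : a * T - 1 = (b * T - 1) - (b * T - 1) * (a * T) + b * ((T * a - 1) * T) := by
    noncomm_ring
  rw [h]
  exact I.add_mem (I.sub_mem hb (I.mul_mem_right _ hb))
    (I.mul_mem_left _ (I.mul_mem_right _ ha))

section FiniteRank

variable (X : Type*) [NormedAddCommGroup X] [NormedSpace ℂ X]

/-- The ideal of operators with finite-dimensional range. -/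
def finiteRankIdeal : Ideal (X →L[ℂ] X) where
  carrier := {T | T.toLinearMap.HasFiniteRange}
  add_mem' := fun hS hT => LinearMap.HasFiniteRange.add hS hT
  zero_mem' := LinearMap.HasFiniteRange.zero
  smul_mem' := fun S _ hT => LinearMap.HasFiniteRange.comp_left hT S.toLinearMap

instance : (finiteRankIdeal X).IsTwoSided :=
  ⟨fun S hT => LinearMap.HasFiniteRange.comp_right hT S.toLinearMap⟩

/-- The ideal of norm limits of finite-rank operators. -/
def approximableIdeal : Ideal (X →L[ℂ] X) := (finiteRankIdeal X).closure

theorem isClosed_approximableIdeal : IsClosed (approximableIdeal X : Set (X →L[ℂ] X)) :=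
  isClosed_closure

instance : (approximableIdeal X).IsTwoSided := ⟨fun S hT =>
  map_mem_closure (f := fun T : X →L[ℂ] X => T * S) (by fun_prop) hT
    fun _ hT => Ideal.mul_mem_right _ _ hT⟩

variable {X}

/-- An operator which is the identity up to an approximable one is the product of an invertible
operator and the identity up to a finite-rank one. -/
theorem exists_unit_sub_mem_finiteRankIdeal [CompleteSpace X] {T : X →L[ℂ] X}
    (hT : T - 1 ∈ approximableIdeal X) : ∃ G : (X →L[ℂ] X)ˣ, T - G ∈ finiteRankIdeal X := by
  obtain ⟨F, hF, hF'⟩ := Metric.mem_closure_iff.1 hT 1 one_pos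
  rw [dist_eq_norm] at hF'
  refine ⟨Units.oneSub (-(T - 1 - F)) (by rwa [norm_neg]), ?_⟩
  have : T - (Units.oneSub (-(T - 1 - F)) (by rwa [norm_neg]) : X →L[ℂ] X) = F := by
    rw [Units.val_oneSub]; abel
  rw [this]
  exact hF

theorem isFredholm_of_isUnit_mk [CompleteSpace X] {T : X →L[ℂ] X}
    (hT : IsUnit (Ideal.Quotient.mk (approximableIdeal X) T)) : T.IsFredholm := by
  obtain ⟨r, hr⟩ := hT.exists_right_inv
  obtain ⟨S, rfl⟩ := Ideal.Quotient.mk_surjective r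
  have hr' : Ideal.Quotient.mk (approximableIdeal X) S *
      Ideal.Quotient.mk (approximableIdeal X) T = 1 := by
    obtain ⟨u, hu⟩ := hT
    rw [← hu] at hr ⊢
    rw [Units.mul_eq_one_iff_inv_eq.1 hr |>.symm, Units.inv_mul]
  have e1 : T * S - 1 ∈ approximableIdeal X := by
    rw [← Ideal.Quotient.eq_zero_iff_mem, map_sub, map_mul, hr, map_one, sub_self]
  have e2 : S * T - 1 ∈ approximableIdeal X := by
    rw [← Ideal.Quotient.eq_zero_iff_mem, map_sub, map_mul, hr', map_one, sub_self]
  obtain ⟨G, hG⟩ := exists_unit_sub_mem_finiteRankIdeal e1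
  obtain ⟨G', hG'⟩ := exists_unit_sub_mem_finiteRankIdeal e2
  have f1 : T * (S * ↑G⁻¹) - 1 ∈ finiteRankIdeal X := by
    have h : T * (S * ↑G⁻¹) - 1 = (T * S - G) * ↑G⁻¹ := by
      rw [sub_mul, Units.mul_inv, mul_assoc]
    rw [h]
    exact Ideal.mul_mem_right _ _ hG
  have f2 : (↑G'⁻¹ * S) * T - 1 ∈ finiteRankIdeal X := by
    have h : (↑G'⁻¹ * S) * T - 1 = ↑G'⁻¹ * (S * T - G') := by
      rw [mul_sub, Units.inv_mul, mul_assoc]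
    rw [h]
    exact Ideal.mul_mem_left _ _ hG'
  have f3 := mul_sub_one_mem_of_left_inverse f1 f2
  refine ContinuousLinearMap.IsFredholm.of_isQuasiInverse (v := S * ↑G⁻¹) ⟨?_, ?_⟩
  · exact LinearMap.FiniteRangeSetoid.equiv_iff_hasFiniteRange.2 f3
  · exact LinearMap.FiniteRangeSetoid.equiv_iff_hasFiniteRange.2 f1

end FiniteRank

namespace DiscreteSchrodinger

section Bounded

variable {N : ℕ} {E : Type*} [NormedAddCommGroup E]

/-- A bounded function as an element of `ℓ^∞`. -/
def ofBounded (f : Lattice N → E) (C : ℝ) (hf : ∀ x, ‖f x‖ ≤ C) : ℓ^∞(Lattice N, E) :=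
  ⟨f, memℓp_infty ⟨C, by rintro _ ⟨x, rfl⟩; exact hf x⟩⟩

@[simp]
theorem ofBounded_apply (f : Lattice N → E) (C : ℝ) (hf : ∀ x, ‖f x‖ ≤ C) (x : Lattice N) :
    ofBounded f C hf x = f x := rfl

theorem norm_apply_le (f : ℓ^∞(Lattice N, E)) (x : Lattice N) : ‖f x‖ ≤ ‖f‖ :=
  lp.norm_apply_le_norm ENNReal.top_ne_zero f x

theorem linfty_sub_apply (f g : ℓ^∞(Lattice N, E)) (x : Lattice N) : (f - g) x = f x - g x := rfl

theorem linfty_mul_apply (f g : ℓ^∞(Lattice N, ℂ)) (x : Lattice N) : (f * g) x = f x * g x := rfl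

/-- The translate `x ↦ f (x + g)` of a bounded function. -/
def translate (g : Lattice N) (f : ℓ^∞(Lattice N, E)) : ℓ^∞(Lattice N, E) :=
  ofBounded (fun x => f (x + g)) ‖f‖ (fun x => norm_apply_le f (x + g))

@[simp]
theorem translate_apply (g : Lattice N) (f : ℓ^∞(Lattice N, E)) (x : Lattice N) :
    translate g f x = f (x + g) := rfl

/-- The constant function. -/
def constBounded (N : ℕ) (c : E) : ℓ^∞(Lattice N, E) := ofBounded (fun _ => c) ‖c‖ fun _ => le_rfl

@[simp]
theorem constBounded_apply (c : E) (x : Lattice N) : constBounded N c x = c := rfl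

/-- The indicator function of a finite set. -/
def indicator (F : Finset (Lattice N)) : ℓ^∞(Lattice N, ℂ) :=
  ofBounded (fun x => if x ∈ F then 1 else 0) 1 fun x => by split_ifs <;> simp

@[simp]
theorem indicator_apply (F : Finset (Lattice N)) (x : Lattice N) :
    indicator F x = if x ∈ F then 1 else 0 := rfl

theorem SlowlyOscillating.star {f : ℓ^∞(Lattice N, ℂ)} (hf : SlowlyOscillating f) :
    SlowlyOscillating (star f) := fun y => by
  have h := (continuous_star.tendsto (0 : ℂ)).comp (hf y)
  rw [star_zero] at h
  refine h.congr fun x => ?_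
  simp

theorem SlowlyOscillating.complexify {Φ : ℓ^∞(Lattice N, ℝ)} (hΦ : SlowlyOscillating Φ) :
    SlowlyOscillating (complexify Φ) := fun y => by
  have h := (Complex.continuous_ofReal.tendsto (0 : ℝ)).comp (hΦ y)
  rw [Complex.ofReal_zero] at h
  refine h.congr fun x => ?_
  simp

end Bounded

variable {N : ℕ} {p : ℝ≥0∞} [Fact (1 ≤ p)]

theorem norm_shift_apply (g : Lattice N) (u : Ell N p) : ‖shift p g u‖ = ‖u‖ := norm_shift g u

theorem norm_shift_le (g : Lattice N) : ‖shift p g‖ ≤ 1 :=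
  ContinuousLinearMap.opNorm_le_bound _ zero_le_one fun u => by rw [norm_shift_apply, one_mul]

theorem shift_mul_shift (g h : Lattice N) : shift p g * shift p h = shift p (g + h) := by
  ext u x
  simp [sub_sub]

theorem shift_zero : shift p (0 : Lattice N) = 1 := by
  ext u x
  simp

theorem norm_mulOp_le (f : ℓ^∞(Lattice N, ℂ)) : ‖mulOp p f‖ ≤ ‖f‖ :=
  lp.norm_mapCLM_le p _ _ _

theorem norm_mulOp_le_of_forall_le (f : ℓ^∞(Lattice N, ℂ)) {C : ℝ} (hC : 0 ≤ C)
    (hf : ∀ x, ‖f x‖ ≤ C) : ‖mulOp p f‖ ≤ C :=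
  (norm_mulOp_le f).trans (lp.norm_le_of_forall_le hC hf)

theorem mulOp_mul (f g : ℓ^∞(Lattice N, ℂ)) : mulOp p (f * g) = mulOp p f * mulOp p g := by
  ext u x
  simp [mul_assoc]

theorem mulOp_sub (f g : ℓ^∞(Lattice N, ℂ)) : mulOp p (f - g) = mulOp p f - mulOp p g := by
  ext u x
  simp [sub_mul]

theorem mulOp_constBounded (c : ℂ) : mulOp p (constBounded N c) = algebraMap ℂ _ c := by
  ext u x
  simp [Algebra.algebraMap_eq_smul_one]

theorem shift_neg_mul_mulOp_mul_shift (g : Lattice N) (f : ℓ^∞(Lattice N, ℂ)) :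
    shift p (-g) * mulOp p f * shift p g = mulOp p (translate g f) := by
  ext u x
  simp

theorem mulOp_mul_indicator_mem_finiteRankIdeal (f : ℓ^∞(Lattice N, ℂ)) (F : Finset (Lattice N)) :
    mulOp p (f * indicator F) ∈ finiteRankIdeal (Ell N p) := by
  have h : mulOp p (f * indicator F) = ∑ i ∈ F, (lp.singleContinuousLinearMap ℂ (fun _ => ℂ) p i) ∘L
      (f i • lp.evalCLM ℂ (fun _ => ℂ) p i) := by
    ext u x
    have h' : (∑ i ∈ F, (lp.singleContinuousLinearMap ℂ (fun _ => ℂ) p i) ∘L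
        (f i • lp.evalCLM ℂ (fun _ => ℂ) p i)) u x = ∑ i ∈ F, if x = i then f i * u i else 0 := by
      rw [sum_apply, lp.coeFn_sum, Finset.sum_apply]
      refine Finset.sum_congr rfl fun i _ => ?_
      change (Pi.single i (f i * u i : ℂ) : Lattice N → ℂ) x = _
      rw [Pi.single_apply]
    rw [h', Finset.sum_ite_eq]
    simp [linfty_mul_apply]
  rw [h]
  refine Ideal.sum_mem _ fun i _ => ?_
  exact LinearMap.HasFiniteRange.comp_right (LinearMap.HasFiniteRange.of_finite_dom) _

theorem mulOp_mem_approximableIdeal {f : ℓ^∞(Lattice N, ℂ)} (hf : Tendsto f cofinite (𝓝 0)) :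
    mulOp p f ∈ approximableIdeal (Ell N p) := by
  refine Metric.mem_closure_iff.2 fun ε hε => ?_
  have hfin : {x | ¬ ‖f x‖ < ε / 2}.Finite := by
    have := (Metric.tendsto_nhds.1 hf) (ε / 2) (half_pos hε)
    simpa only [dist_zero_right, eventually_cofinite] using this
  refine ⟨_, mulOp_mul_indicator_mem_finiteRankIdeal f hfin.toFinset, ?_⟩
  rw [dist_eq_norm, ← mulOp_sub]
  refine (norm_mulOp_le_of_forall_le _ (half_pos hε).le fun x => ?_).trans_lt (half_lt_self hε)
  rw [linfty_sub_apply, linfty_mul_apply, indicator_apply]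
  split_ifs with h
  · simpa using (half_pos hε).le
  · simpa using (not_le.1 fun h' => h (hfin.mem_toFinset.2 (not_lt.2 h'))).le

theorem isUnit_mk_mulOp {f : ℓ^∞(Lattice N, ℂ)} {ε : ℝ} (hε : 0 < ε)
    (hf : ∀ᶠ x in cofinite, ε ≤ ‖f x‖) :
    IsUnit (Ideal.Quotient.mk (approximableIdeal (Ell N p)) (mulOp p f)) := by
  let g : ℓ^∞(Lattice N, ℂ) := ofBounded (fun x => if ε ≤ ‖f x‖ then (f x)⁻¹ else 0) ε⁻¹ fun x => by
    split_ifs with h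
    · rw [norm_inv]; gcongr
    · simpa using hε.le
  have hfg : mulOp p f * mulOp p g - 1 ∈ approximableIdeal (Ell N p) := by
    rw [← map_one (algebraMap ℂ _), ← mulOp_constBounded, ← mulOp_mul, ← mulOp_sub]
    refine mulOp_mem_approximableIdeal (tendsto_const_nhds.congr' ?_)
    filter_upwards [hf] with x hx
    have : f x ≠ 0 := norm_pos_iff.1 (hε.trans_le hx)
    rw [linfty_sub_apply, linfty_mul_apply]
    simp [g, hx, this]
  have hgf : mulOp p g * mulOp p f - 1 ∈ approximableIdeal (Ell N p) := by
    rwa [← mulOp_mul, mul_comm, mulOp_mul]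
  rw [← Ideal.Quotient.eq_zero_iff_mem, map_sub, map_mul, map_one, sub_eq_zero] at hfg hgf
  exact ⟨⟨_, _, hfg, hgf⟩, rfl⟩

theorem shift_mul_mulOp_sub_mem {f : ℓ^∞(Lattice N, ℂ)} (hf : SlowlyOscillating f) (g : Lattice N) :
    shift p g * mulOp p f - mulOp p f * shift p g ∈ approximableIdeal (Ell N p) := by
  have h : shift p g * mulOp p f - mulOp p f * shift p g =
      mulOp p (translate (-g) f - f) * shift p g := by
    ext u x
    change f (x - g) * u (x - g) - f x * u (x - g) = (f (x + -g) - f x) * u (x - g)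
    rw [← sub_eq_add_neg, sub_mul]
  rw [h]
  exact Ideal.mul_mem_right _ _ (mulOp_mem_approximableIdeal (hf (-g)))

variable (N p) in
/-- The shifts and the multiplications by slowly oscillating functions. -/
def slowlyOscillatingGenerators : Set (Ell N p →L[ℂ] Ell N p) :=
  Set.range (shift p) ∪ mulOp p '' {f | SlowlyOscillating f}

theorem commutator_mem_approximableIdeal :
    ∀ x ∈ slowlyOscillatingGenerators N p, ∀ y ∈ slowlyOscillatingGenerators N p,
      x * y - y * x ∈ approximableIdeal (Ell N p) := by
  rintro _ (⟨g, rfl⟩ | ⟨f, hf, rfl⟩) _ (⟨g', rfl⟩ | ⟨f', hf', rfl⟩)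
  · rw [shift_mul_shift, shift_mul_shift, add_comm, sub_self]; exact Ideal.zero_mem _
  · exact shift_mul_mulOp_sub_mem hf' g
  · rw [← neg_sub]; exact Ideal.neg_mem_iff _ |>.2 (shift_mul_mulOp_sub_mem hf g')
  · rw [← mulOp_mul, ← mulOp_mul, mul_comm, sub_self]; exact Ideal.zero_mem _

section Character

variable {𝒜 : Subalgebra ℂ (Ell N p →L[ℂ] Ell N p)} {χ : 𝒜 →ₐ[ℂ] ℂ}

theorem norm_character_le_one (hχ : ∀ y : 𝒜,
      IsUnit (Ideal.Quotient.mk (approximableIdeal (Ell N p)) (y : Ell N p →L[ℂ] Ell N p)) →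
        χ y ≠ 0) (y : 𝒜) (hy : ‖(y : Ell N p →L[ℂ] Ell N p)‖ ≤ 1) : ‖χ y‖ ≤ 1 := by
  by_contra! h
  have hmem : χ y ∈ resolventSet ℂ (y : Ell N p →L[ℂ] Ell N p) := by
    refine spectrum.mem_resolventSet_of_norm_lt_mul (lt_of_le_of_lt ?_ h)
    exact mul_le_one₀ hy (norm_nonneg _) ContinuousLinearMap.norm_id_le
  exact hχ (algebraMap ℂ 𝒜 (χ y) - y) (hmem.map (Ideal.Quotient.mk _)) (by simp)

theorem mapClusterPt_character_mulOp (hχ : ∀ y : 𝒜,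
      IsUnit (Ideal.Quotient.mk (approximableIdeal (Ell N p)) (y : Ell N p →L[ℂ] Ell N p)) →
        χ y ≠ 0) (f : ℓ^∞(Lattice N, ℂ)) (hf : mulOp p f ∈ 𝒜) :
    MapClusterPt (χ ⟨mulOp p f, hf⟩) cofinite f := by
  rw [mapClusterPt_iff_frequently]
  intro s hs
  obtain ⟨ε, hε, hεs⟩ := Metric.mem_nhds_iff.1 hs
  refine Frequently.mono ?_ fun x hx => hεs hx
  rw [Filter.Frequently]
  intro h
  refine hχ (⟨mulOp p f, hf⟩ - algebraMap ℂ 𝒜 (χ ⟨mulOp p f, hf⟩)) ?_ (by simp)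
  have : ((⟨mulOp p f, hf⟩ - algebraMap ℂ 𝒜 (χ ⟨mulOp p f, hf⟩) : 𝒜) : Ell N p →L[ℂ] Ell N p) =
      mulOp p (f - constBounded N (χ ⟨mulOp p f, hf⟩)) := by
    rw [mulOp_sub, mulOp_constBounded]; rfl
  rw [this]
  refine isUnit_mk_mulOp hε ?_
  filter_upwards [h] with x hx
  simpa [dist_eq_norm] using hx

end Character

theorem mapClusterPt_eq_of_tendsto {X Y : Type*} [TopologicalSpace Y] [T2Space Y] {l : Filter X}
    {f : X → Y} {a b : Y} (h : MapClusterPt a l f) (hb : Tendsto f l (𝓝 b)) : a = b := by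
  have : (𝓝 a ⊓ 𝓝 b).NeBot := (h.clusterPt.mono hb).neBot
  exact eq_of_nhds_neBot this

theorem eq_conj_of_mul_eq_one {v w : ℂ} (hv : ‖v‖ = 1) (h : v * w = 1) : w = conj v := by
  rw [← Complex.inv_eq_conj hv]
  exact eq_inv_of_mul_eq_one_right h

theorem algHom_sum_sub_mul_sub {ι A : Type*} [Fintype ι] [Ring A] [Algebra ℂ A] (χ : A →ₐ[ℂ] ℂ)
    (x y x' y' : ι → A) (m : A) (z : ℂ) :
    χ (∑ k, (x k - y k) * (x' k - y' k) + m - algebraMap ℂ A z) =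
      ∑ k, (χ (x k) - χ (y k)) * (χ (x' k) - χ (y' k)) + χ m - z := by
  simp

theorem essSpectrum_schrodinger_subset (a : Fin N → ℓ^∞(Lattice N, ℂ)) (Φ : ℓ^∞(Lattice N, ℝ))
    (ha : ∀ k, SlowlyOscillating (a k)) (ha1 : ∀ k, Tendsto (fun x => ‖a k x‖) cofinite (𝓝 1))
    (hΦ : SlowlyOscillating Φ) {z : ℂ} (hz : z ∈ essSpectrum (schrodinger p a Φ)) :
    ∃ c : ℝ, MapClusterPt c cofinite Φ ∧ z ∈ Complex.ofReal '' Set.Icc c (c + 4 * N) := by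
  obtain ⟨𝒜, hs, h𝒜⟩ := exists_subalgebra_forall_exists_character_quotient
    (approximableIdeal (Ell N p)) (isClosed_approximableIdeal _) _
    (commutator_mem_approximableIdeal (N := N) (p := p))
  let S (g : Lattice N) : 𝒜 := ⟨shift p g, hs (Or.inl ⟨g, rfl⟩)⟩
  have hM {f : ℓ^∞(Lattice N, ℂ)} (hf : SlowlyOscillating f) : mulOp p f ∈ 𝒜 :=
    hs (Or.inr ⟨f, hf, rfl⟩)
  let T : 𝒜 := ∑ k, (S (Pi.single k 1) - ⟨_, hM (ha k)⟩) *
    (S (-Pi.single k 1) - ⟨_, hM (ha k).star⟩) + ⟨_, hM hΦ.complexify⟩ - algebraMap ℂ 𝒜 z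
  have hT : (T : Ell N p →L[ℂ] Ell N p) =
      schrodinger p a Φ - z • ContinuousLinearMap.id ℂ (Ell N p) := by
    simp only [T, schrodinger, AddSubgroupClass.coe_sub, AddMemClass.coe_add,
      AddSubmonoidClass.coe_finsetSum, MulMemClass.coe_mul, S]
    rfl
  obtain ⟨χ, hχT, hχ⟩ := h𝒜 T (fun h => hz (isFredholm_of_isUnit_mk (hT ▸ h)))
  have hSmul (g : Lattice N) : χ (S g) * χ (S (-g)) = 1 := by
    have h : S g * S (-g) = 1 := Subtype.ext (by
      change shift p g * shift p (-g) = 1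
      rw [shift_mul_shift, add_neg_cancel, shift_zero])
    rw [← map_mul, h, map_one]
  have hSle (g : Lattice N) : ‖χ (S g)‖ ≤ 1 := norm_character_le_one hχ (S g) (norm_shift_le g)
  have hS (g : Lattice N) : ‖χ (S g)‖ = 1 := by
    have h := congrArg norm (hSmul g)
    rw [norm_mul, norm_one] at h
    nlinarith [hSle g, hSle (-g), norm_nonneg (χ (S g)), norm_nonneg (χ (S (-g)))]
  have hS' (g : Lattice N) : χ (S (-g)) = conj (χ (S g)) := eq_conj_of_mul_eq_one (hS g) (hSmul g)
  have hA (k : Fin N) : ‖χ ⟨_, hM (ha k)⟩‖ = 1 :=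
    mapClusterPt_eq_of_tendsto ((mapClusterPt_character_mulOp hχ _ (hM (ha k))).continuousAt_comp
      continuous_norm.continuousAt) (ha1 k)
  have hAmul (k : Fin N) : χ ⟨_, hM (ha k)⟩ * χ ⟨_, hM (ha k).star⟩ = 1 := by
    have hmem : mulOp p (a k * star (a k)) ∈ 𝒜 := by
      rw [mulOp_mul]; exact 𝒜.mul_mem (hM (ha k)) (hM (ha k).star)
    have h : (⟨_, hM (ha k)⟩ * ⟨_, hM (ha k).star⟩ : 𝒜) = ⟨_, hmem⟩ :=
      Subtype.ext (mulOp_mul _ _).symm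
    rw [← map_mul, h]
    refine mapClusterPt_eq_of_tendsto (mapClusterPt_character_mulOp hχ _ hmem) ?_
    have h2 := (Complex.continuous_ofReal.tendsto _).comp ((ha1 k).pow 2)
    rw [one_pow, Complex.ofReal_one] at h2
    refine h2.congr fun x => ?_
    simp [Complex.mul_conj']
  have hA' (k : Fin N) := eq_conj_of_mul_eq_one (hA k) (hAmul k)
  have hc := mapClusterPt_character_mulOp hχ _ (hM hΦ.complexify)
  set lam := χ ⟨_, hM hΦ.complexify⟩
  have hlam : ((lam.re : ℝ) : ℂ) = lam := by
    have h0 : lam.im = 0 := mapClusterPt_eq_of_tendsto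
      (hc.continuousAt_comp Complex.continuous_im.continuousAt)
      (tendsto_const_nhds.congr fun x => by simp)
    exact Complex.ext rfl (by simp [h0])
  refine ⟨lam.re, hc.continuousAt_comp Complex.continuous_re.continuousAt,
    ∑ k, ‖χ (S (Pi.single k 1)) - χ ⟨_, hM (ha k)⟩‖ ^ 2 + lam.re, ⟨?_, ?_⟩, ?_⟩
  · have : 0 ≤ ∑ k, ‖χ (S (Pi.single k 1)) - χ ⟨_, hM (ha k)⟩‖ ^ 2 :=
      Finset.sum_nonneg fun k _ => by positivity
    linarith
  · have : ∑ k, ‖χ (S (Pi.single k 1)) - χ ⟨_, hM (ha k)⟩‖ ^ 2 ≤ ∑ _k : Fin N, (4 : ℝ) := by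
      refine Finset.sum_le_sum fun k _ => ?_
      have h := norm_sub_le (χ (S (Pi.single k 1))) (χ ⟨_, hM (ha k)⟩)
      rw [hS, hA] at h
      nlinarith [norm_nonneg (χ (S (Pi.single k 1)) - χ ⟨_, hM (ha k)⟩)]
    rw [Finset.sum_const, Finset.card_univ, Fintype.card_fin, nsmul_eq_mul] at this
    linarith
  · rw [algHom_sum_sub_mul_sub, sub_eq_zero] at hχT
    rw [← hχT]
    push_cast
    rw [hlam]
    congr 1
    refine Finset.sum_congr rfl fun k _ => ?_
    rw [hS', hA', ← map_sub (starRingEnd ℂ), Complex.mul_conj']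

theorem tendsto_zero_of_forall_le_add {n : ℕ → ℝ} (hn : ∀ j, 0 ≤ n j)
    (h : ∀ ε > 0, ∃ m : ℕ → ℝ, Tendsto m atTop (𝓝 0) ∧ ∀ j, n j ≤ m j + ε) :
    Tendsto n atTop (𝓝 0) := by
  rw [Metric.tendsto_nhds]
  intro ε hε
  obtain ⟨m, hm, hnm⟩ := h (ε / 2) (half_pos hε)
  filter_upwards [hm.eventually_lt_const (half_pos hε)] with j hj
  rw [dist_zero_right, Real.norm_of_nonneg (hn j)]
  linarith [hnm j]

omit [Fact (1 ≤ p)] in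
theorem norm_rpow_add_of_disjoint (hp : 0 < p.toReal) {u v : Ell N p}
    (h : ∀ x, u x = 0 ∨ v x = 0) :
    ‖u + v‖ ^ p.toReal = ‖u‖ ^ p.toReal + ‖v‖ ^ p.toReal := by
  rw [lp.norm_rpow_eq_tsum hp, lp.norm_rpow_eq_tsum hp, lp.norm_rpow_eq_tsum hp,
    ← ((lp.memℓp u).summable hp).tsum_add ((lp.memℓp v).summable hp)]
  refine tsum_congr fun x => ?_
  change ‖u x + v x‖ ^ p.toReal = _
  rcases h x with h | h <;> simp [h, Real.zero_rpow hp.ne']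

theorem tendsto_mulOp_indicator (hp' : p ≠ ∞) (u : Ell N p) :
    Tendsto (fun F => mulOp p (indicator F) u) atTop (𝓝 u) := by
  refine (lp.hasSum_single hp' u).congr fun F => ?_
  ext x
  rw [lp.coeFn_sum, Finset.sum_apply, mulOp_apply, indicator_apply]
  simp

theorem norm_mulOp_apply_le (f : ℓ^∞(Lattice N, ℂ)) (hf : ∀ x, ‖f x‖ ≤ 1) (u : Ell N p) :
    ‖mulOp p f u‖ ≤ ‖u‖ := by
  have h := (mulOp p f).le_of_opNorm_le (norm_mulOp_le_of_forall_le f zero_le_one hf) u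
  rwa [one_mul] at h

theorem exists_norm_mul_eq_norm (w : ℂ) : ∃ c : ℂ, ‖c‖ = 1 ∧ c * w = ‖w‖ := by
  by_cases hw : w = 0
  · exact ⟨1, by simp [hw]⟩
  · have hw' : (‖w‖ : ℂ) ≠ 0 := by simpa using hw
    refine ⟨conj w / ‖w‖, by simp [hw], ?_⟩
    rw [div_mul_eq_mul_div, mul_comm, Complex.mul_conj', sq, mul_div_assoc, div_self hw', mul_one]

/-- A functional on `l^p`, `1 < p < ∞`, is small on functions vanishing on a large finite set. -/
theorem exists_norm_comp_mulOp_one_sub_indicator_le (hp : 1 < p) (hp' : p ≠ ∞)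
    (φ : StrongDual ℂ (Ell N p)) {ε : ℝ} (hε : 0 < ε) :
    ∃ F : Finset (Lattice N),
      ‖φ ∘L mulOp p (constBounded N 1 - indicator F)‖ ≤ ε := by
  have hP : 1 < p.toReal := by
    rw [← ENNReal.toReal_one]; exact (ENNReal.toReal_lt_toReal ENNReal.one_ne_top hp').2 hp
  have hP0 : 0 < p.toReal := zero_lt_one.trans hP
  obtain ⟨t, ht, htε⟩ : ∃ t : ℝ, 0 < t ∧ ‖φ‖ * t ^ (p.toReal - 1) < ε / 2 := by
    have h : Tendsto (fun t : ℝ => ‖φ‖ * t ^ (p.toReal - 1)) (𝓝[>] 0) (𝓝 0) := by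
      have h1 := ((Real.continuousAt_rpow_const 0 (p.toReal - 1)
        (Or.inr (by linarith))).tendsto.const_mul ‖φ‖)
      rw [Real.zero_rpow (by linarith), mul_zero] at h1
      exact h1.mono_left nhdsWithin_le_nhds
    obtain ⟨t, h1, h2⟩ := ((h.eventually_lt_const (half_pos hε)).and self_mem_nhdsWithin).exists
    exact ⟨t, h2, h1⟩
  obtain ⟨F, u, hu, hu1, huφ⟩ : ∃ (F : Finset (Lattice N)) (u : Ell N p),
      (∀ x, x ∉ F → u x = 0) ∧ ‖u‖ ≤ 1 ∧ ‖φ‖ - t * (ε / 2) < ‖φ u‖ := by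
    obtain ⟨u, hu, huφ⟩ := φ.exists_lt_apply_of_lt_opNorm
      (show ‖φ‖ - t * (ε / 2) < ‖φ‖ by have := mul_pos ht (half_pos hε); linarith)
    have h := ((φ.continuous.norm.tendsto u).comp (tendsto_mulOp_indicator hp' u))
    obtain ⟨F, hF⟩ := (h.eventually_const_lt huφ).exists
    refine ⟨F, mulOp p (indicator F) u, fun x hx => by simp [hx], ?_, hF⟩
    refine (norm_mulOp_apply_le _ (fun x => ?_) u).trans hu.le
    rw [indicator_apply]; split_ifs <;> simp
  refine ⟨F, ?_⟩
  by_contra! hlt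
  obtain ⟨w, hw, hwφ⟩ := ContinuousLinearMap.exists_lt_apply_of_lt_opNorm _ hlt
  rw [ContinuousLinearMap.comp_apply] at hwφ
  set v := mulOp p (constBounded N 1 - indicator F) w with hv_def
  have hv (x : Lattice N) : v x = if x ∈ F then 0 else w x := by
    rw [hv_def, mulOp_apply, linfty_sub_apply, indicator_apply, constBounded_apply]
    split_ifs <;> simp
  have hv1 : ‖v‖ ≤ 1 := by
    refine (norm_mulOp_apply_le _ (fun x => ?_) w).trans hw.le
    rw [linfty_sub_apply, indicator_apply, constBounded_apply]
    split_ifs <;> simp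
  obtain ⟨c, hc, hcu⟩ := exists_norm_mul_eq_norm (φ u)
  obtain ⟨d, hd, hdv⟩ := exists_norm_mul_eq_norm (φ v)
  have hφ : ‖φ (c • u + ((t : ℂ) * d) • v)‖ = ‖φ u‖ + t * ‖φ v‖ := by
    rw [map_add, map_smul, map_smul, smul_eq_mul, smul_eq_mul, mul_assoc, hcu, hdv,
      ← Complex.ofReal_mul, ← Complex.ofReal_add, Complex.norm_real,
      Real.norm_of_nonneg (by positivity)]
  have hnorm : ‖c • u + ((t : ℂ) * d) • v‖ ≤ 1 + t ^ p.toReal := by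
    have h1 : ‖c • u + ((t : ℂ) * d) • v‖ ^ p.toReal ≤ 1 + t ^ p.toReal := by
      rw [norm_rpow_add_of_disjoint hP0 fun x => ?_, norm_smul, norm_smul, norm_mul, hc, hd,
        Complex.norm_real, Real.norm_of_nonneg ht.le, one_mul, mul_one,
        Real.mul_rpow ht.le (norm_nonneg _)]
      · have e1 := Real.rpow_le_one (norm_nonneg u) hu1 hP0.le
        have e2 := Real.rpow_le_one (norm_nonneg v) hv1 hP0.le
        have e3 := mul_le_of_le_one_right (Real.rpow_nonneg ht.le p.toReal) e2
        linarith
      · by_cases hx : x ∈ F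
        · right; change _ * v x = 0; rw [hv, if_pos hx, mul_zero]
        · left; change _ * u x = 0; rw [hu x hx, mul_zero]
    by_contra! h2
    have h3 : (1 : ℝ) ≤ 1 + t ^ p.toReal := le_add_of_nonneg_right (Real.rpow_nonneg ht.le _)
    have h4 := Real.rpow_le_rpow_of_exponent_le (h3.trans h2.le) hP.le
    rw [Real.rpow_one] at h4
    linarith
  have h := φ.le_opNorm (c • u + ((t : ℂ) * d) • v)
  rw [hφ] at h
  have h' := h.trans (mul_le_mul_of_nonneg_left hnorm (norm_nonneg φ))
  have ht' : t ^ p.toReal = t ^ (p.toReal - 1) * t := by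
    rw [← Real.rpow_add_one ht.ne', sub_add_cancel]
  rw [ht'] at h'
  have h5 : t * ‖φ v‖ < t * ε := by nlinarith
  linarith [lt_of_mul_lt_mul_left h5 ht.le]

/-- Strong convergence of a bounded sequence of operators and of their adjoints. -/
structure StrongStarTendsto (T : ℕ → Ell N p →L[ℂ] Ell N p) (S : Ell N p →L[ℂ] Ell N p) :
    Prop where
  bounded : ∃ C, ∀ j, ‖T j‖ ≤ C
  strong : ∀ u, Tendsto (fun j => T j u) atTop (𝓝 (S u))
  strong_adjoint : ∀ φ : StrongDual ℂ (Ell N p),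
    Tendsto (fun j => φ ∘L T j) atTop (𝓝 (φ ∘L S))

namespace StrongStarTendsto

variable {T T' : ℕ → Ell N p →L[ℂ] Ell N p} {S S' : Ell N p →L[ℂ] Ell N p}

theorem const (S : Ell N p →L[ℂ] Ell N p) : StrongStarTendsto (fun _ => S) S :=
  ⟨⟨‖S‖, fun _ => le_rfl⟩, fun _ => tendsto_const_nhds, fun _ => tendsto_const_nhds⟩

theorem add (h : StrongStarTendsto T S) (h' : StrongStarTendsto T' S') :
    StrongStarTendsto (fun j => T j + T' j) (S + S') := by
  obtain ⟨C, hC⟩ := h.bounded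
  obtain ⟨C', hC'⟩ := h'.bounded
  refine ⟨⟨C + C', fun j => (norm_add_le _ _).trans (add_le_add (hC j) (hC' j))⟩,
    fun u => (h.strong u).add (h'.strong u), fun φ => ?_⟩
  simp only [ContinuousLinearMap.comp_add]
  exact (h.strong_adjoint φ).add (h'.strong_adjoint φ)

theorem neg (h : StrongStarTendsto T S) : StrongStarTendsto (fun j => -T j) (-S) := by
  obtain ⟨C, hC⟩ := h.bounded
  refine ⟨⟨C, fun j => by rw [norm_neg]; exact hC j⟩, fun u => (h.strong u).neg, fun φ => ?_⟩
  simp only [ContinuousLinearMap.comp_neg]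
  exact (h.strong_adjoint φ).neg

theorem sub (h : StrongStarTendsto T S) (h' : StrongStarTendsto T' S') :
    StrongStarTendsto (fun j => T j - T' j) (S - S') := by
  simp only [sub_eq_add_neg]
  exact h.add h'.neg

theorem sum {ι : Type*} (s : Finset ι) {T : ι → ℕ → Ell N p →L[ℂ] Ell N p}
    {S : ι → Ell N p →L[ℂ] Ell N p} (h : ∀ i, StrongStarTendsto (T i) (S i)) :
    StrongStarTendsto (fun j => ∑ i ∈ s, T i j) (∑ i ∈ s, S i) := by
  classical
  induction s using Finset.induction_on with
  | empty => simpa using const 0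
  | insert i s hi ih => simpa only [Finset.sum_insert hi] using (h i).add ih

theorem comp (h : StrongStarTendsto T S) (h' : StrongStarTendsto T' S') :
    StrongStarTendsto (fun j => T j ∘L T' j) (S ∘L S') := by
  obtain ⟨C, hC⟩ := h.bounded
  obtain ⟨C', hC'⟩ := h'.bounded
  have hC0 : 0 ≤ C := (norm_nonneg _).trans (hC 0)
  refine ⟨⟨C * C', fun j => (ContinuousLinearMap.opNorm_comp_le _ _).trans
    (mul_le_mul (hC j) (hC' j) (norm_nonneg _) hC0)⟩, fun u => ?_, fun φ => ?_⟩
  · have h1 : Tendsto (fun j => T j (T' j u - S' u)) atTop (𝓝 0) := by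
      refine squeeze_zero_norm (fun j => (T j).le_of_opNorm_le (hC j) _) ?_
      have := ((h'.strong u).sub_const (S' u)).norm.const_mul C
      simpa using this
    have h2 := h1.add (h.strong (S' u))
    simpa using h2
  · have h1 : Tendsto (fun j => (φ ∘L T j - φ ∘L S) ∘L T' j) atTop (𝓝 0) := by
      refine squeeze_zero_norm (fun j => (ContinuousLinearMap.opNorm_comp_le _ _).trans
        (mul_le_mul_of_nonneg_left (hC' j) (norm_nonneg _))) ?_
      have := ((h.strong_adjoint φ).sub_const (φ ∘L S)).norm.mul_const C'
      simpa using this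
    have h2 := h1.add (h'.strong_adjoint (φ ∘L S))
    simp only [ContinuousLinearMap.sub_comp, ContinuousLinearMap.comp_assoc, sub_add_cancel,
      zero_add] at h2
    exact h2

end StrongStarTendsto

theorem tendsto_norm_mulOp_mul_indicator {g : ℕ → ℓ^∞(Lattice N, ℂ)}
    (hg : ∀ x, Tendsto (fun j => g j x) atTop (𝓝 0)) (F : Finset (Lattice N)) :
    Tendsto (fun j => ‖mulOp p (g j * indicator F)‖) atTop (𝓝 0) := by
  have h : Tendsto (fun j => ∑ x ∈ F, ‖g j x‖) atTop (𝓝 0) := by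
    simpa using tendsto_finsetSum F fun x _ => (hg x).norm
  refine squeeze_zero (fun _ => norm_nonneg _) (fun j => norm_mulOp_le_of_forall_le _
    (Finset.sum_nonneg fun _ _ => norm_nonneg _) fun x => ?_) h
  rw [linfty_mul_apply, indicator_apply]
  split_ifs with hx
  · rw [mul_one]; exact Finset.single_le_sum (f := fun x => ‖g j x‖) (fun _ _ => norm_nonneg _) hx
  · rw [mul_zero, norm_zero]; exact Finset.sum_nonneg fun _ _ => norm_nonneg _

theorem mulOp_eq_mul_indicator_add (g : ℓ^∞(Lattice N, ℂ)) (F : Finset (Lattice N)) :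
    mulOp p g = mulOp p (g * indicator F) +
      mulOp p (constBounded N 1 - indicator F) * mulOp p g := by
  rw [mulOp_sub, mulOp_constBounded, map_one, mulOp_mul, sub_mul, one_mul, ← mulOp_mul,
    ← mulOp_mul, mul_comm g]
  abel

theorem strongStarTendsto_mulOp_zero (hp : 1 < p) (hp' : p ≠ ∞) {g : ℕ → ℓ^∞(Lattice N, ℂ)}
    {C : ℝ} (hC : ∀ j, ‖g j‖ ≤ C) (hg : ∀ x, Tendsto (fun j => g j x) atTop (𝓝 0)) :
    StrongStarTendsto (fun j => mulOp p (g j)) 0 := by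
  have hC0 : 0 ≤ C := (norm_nonneg _).trans (hC 0)
  refine ⟨⟨C, fun j => (norm_mulOp_le _).trans (hC j)⟩, fun u => ?_, fun φ => ?_⟩
  · rw [zero_apply, tendsto_zero_iff_norm_tendsto_zero]
    refine tendsto_zero_of_forall_le_add (fun _ => norm_nonneg _) fun ε hε => ?_
    have h := ((tendsto_mulOp_indicator hp' u).const_sub u).norm.const_mul C
    rw [sub_self, norm_zero, mul_zero] at h
    obtain ⟨F, hF⟩ := (h.eventually_lt_const hε).exists
    refine ⟨fun j => ‖mulOp p (g j * indicator F)‖ * ‖u‖, ?_, fun j => ?_⟩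
    · simpa using (tendsto_norm_mulOp_mul_indicator (p := p) hg F).mul_const ‖u‖
    · have hu : mulOp p (g j) u = mulOp p (g j * indicator F) u +
          mulOp p (g j) (u - mulOp p (indicator F) u) := by
        rw [map_sub, mulOp_mul]; simp
      rw [hu]
      refine (norm_add_le _ _).trans (add_le_add (ContinuousLinearMap.le_opNorm _ _) ?_)
      exact ((mulOp p (g j)).le_of_opNorm_le ((norm_mulOp_le _).trans (hC j)) _).trans hF.le
  · rw [ContinuousLinearMap.comp_zero, tendsto_zero_iff_norm_tendsto_zero]
    refine tendsto_zero_of_forall_le_add (fun _ => norm_nonneg _) fun ε hε => ?_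
    obtain ⟨F, hF⟩ := exists_norm_comp_mulOp_one_sub_indicator_le hp hp' φ
      (show 0 < ε / (C + 1) by positivity)
    refine ⟨fun j => ‖φ‖ * ‖mulOp p (g j * indicator F)‖, ?_, fun j => ?_⟩
    · simpa using (tendsto_norm_mulOp_mul_indicator (p := p) hg F).const_mul ‖φ‖
    · have hu : φ ∘L mulOp p (g j) = φ ∘L mulOp p (g j * indicator F) +
          (φ ∘L mulOp p (constBounded N 1 - indicator F)) ∘L mulOp p (g j) := by
        conv_lhs => rw [mulOp_eq_mul_indicator_add (g j) F]
        rw [ContinuousLinearMap.comp_add]; rfl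
      rw [hu]
      refine (norm_add_le _ _).trans (add_le_add (ContinuousLinearMap.opNorm_comp_le _ _) ?_)
      refine (ContinuousLinearMap.opNorm_comp_le _ _).trans ((mul_le_mul hF
        ((norm_mulOp_le _).trans (hC j)) (norm_nonneg _) (by positivity)).trans ?_)
      rw [div_mul_eq_mul_div, div_le_iff₀ (by positivity)]
      nlinarith

theorem strongStarTendsto_mulOp (hp : 1 < p) (hp' : p ≠ ∞) {g : ℕ → ℓ^∞(Lattice N, ℂ)}
    {f : ℓ^∞(Lattice N, ℂ)} {C : ℝ} (hC : ∀ j, ‖g j‖ ≤ C)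
    (hg : ∀ x, Tendsto (fun j => g j x) atTop (𝓝 (f x))) :
    StrongStarTendsto (fun j => mulOp p (g j)) (mulOp p f) := by
  have h : StrongStarTendsto (fun j => mulOp p (g j - f)) 0 :=
    strongStarTendsto_mulOp_zero hp hp' (C := C + ‖f‖)
      (fun j => (norm_sub_le _ _).trans (add_le_add_left (hC j) _)) fun x => by
        have := (hg x).sub_const (f x)
        rwa [sub_self] at this
  have h2 := h.add (StrongStarTendsto.const (mulOp p f))
  simpa only [mulOp_sub, sub_add_cancel, zero_add] using h2

theorem schrodinger_apply (a : Fin N → ℓ^∞(Lattice N, ℂ)) (Φ : ℓ^∞(Lattice N, ℝ)) (u : Ell N p)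
    (x : Lattice N) : schrodinger p a Φ u x =
      ∑ k, ((u x - conj (a k (x - Pi.single k 1)) * u (x - Pi.single k 1)) -
        a k x * (u (x + Pi.single k 1) - conj (a k x) * u x)) + Φ x * u x := by
  rw [schrodinger, add_apply, sum_apply]
  change (∑ k, _ : Ell N p) x + _ = _
  rw [lp.coeFn_sum, Finset.sum_apply]
  congr 1
  refine Finset.sum_congr rfl fun k _ => ?_
  change (u (x - Pi.single k 1 - -Pi.single k 1) -
    mulOp p (star (a k)) u (x - Pi.single k 1)) -
    mulOp p (a k) (shift p (-Pi.single k 1) u - mulOp p (star (a k)) u) x = _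
  rw [mulOp_apply, mulOp_apply]
  change _ - a k x * (u (x - -Pi.single k 1) - mulOp p (star (a k)) u x) = _
  rw [mulOp_apply]
  simp

theorem shift_neg_comp_schrodinger_comp_shift (a : Fin N → ℓ^∞(Lattice N, ℂ))
    (Φ : ℓ^∞(Lattice N, ℝ)) (h : Lattice N) :
    shift p (-h) ∘L schrodinger p a Φ ∘L shift p h =
      schrodinger p (fun k => translate h (a k)) (translate h Φ) := by
  ext u x
  have h1 (y : Lattice N) : x + h - y = x - y + h := by abel
  have h2 (y : Lattice N) : x + h + y = x + y + h := by abel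
  simp only [ContinuousLinearMap.comp_apply, shift_apply, schrodinger_apply, translate_apply,
    sub_neg_eq_add, h1, h2, add_sub_cancel_right, sub_add_cancel]

theorem exists_seq_tendsto_of_mapClusterPt {X Y : Type*} [TopologicalSpace Y]
    [FirstCountableTopology Y] {l : Filter X} [l.IsCountablyGenerated] {f : X → Y} {c : Y}
    (h : MapClusterPt c l f) :
    ∃ g : ℕ → X, Tendsto g atTop l ∧ Tendsto (fun j => f (g j)) atTop (𝓝 c) := by
  have hne : (l ⊓ comap f (𝓝 c)).NeBot := by
    rw [← map_neBot_iff f, Filter.push_pull, inf_comm]; exact h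
  obtain ⟨g, hg⟩ := exists_seq_tendsto (l ⊓ comap f (𝓝 c))
  rw [tendsto_inf, tendsto_comap_iff] at hg
  exact ⟨g, hg.1, hg.2⟩

theorem exists_isLimitOperator (hp : 1 < p) (hp' : p ≠ ∞)
    (a : Fin N → ℓ^∞(Lattice N, ℂ)) (Φ : ℓ^∞(Lattice N, ℝ))
    (ha : ∀ k, SlowlyOscillating (a k)) (ha1 : ∀ k, Tendsto (fun x => ‖a k x‖) cofinite (𝓝 1))
    (hΦ : SlowlyOscillating Φ) {c : ℝ} (hc : MapClusterPt c cofinite Φ) :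
    ∃ (g : ℕ → Lattice N) (α : Fin N → ℂ), (∀ k, ‖α k‖ = 1) ∧
      Tendsto (fun j => Φ (g j)) atTop (𝓝 c) ∧
      IsLimitOperator (schrodinger p a Φ) g
        (schrodinger p (fun k => constBounded N (α k)) (constBounded N c)) := by
  have : (cofinite : Filter (Lattice N)).IsCountablyGenerated :=
    HasCountableBasis.isCountablyGenerated ⟨hasBasis_cofinite, Set.Countable.ofPred_finite⟩
  obtain ⟨g₀, hg₀, hg₀c⟩ := exists_seq_tendsto_of_mapClusterPt hc
  have hb : Bornology.IsBounded
      (Metric.closedBall (0 : Fin N → ℂ) (∑ k, ‖a k‖)) := Metric.isBounded_closedBall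
  obtain ⟨α, -, σ, hσ, hα⟩ := tendsto_subseq_of_bounded hb (x := fun j k => a k (g₀ j)) fun j => by
    rw [mem_closedBall_zero_iff, pi_norm_le_iff_of_nonneg (Finset.sum_nonneg fun _ _ => norm_nonneg _)]
    exact fun k => (norm_apply_le _ _).trans
      (Finset.single_le_sum (f := fun k => ‖a k‖) (fun _ _ => norm_nonneg _) (Finset.mem_univ k))
  set g := g₀ ∘ σ with hg_def
  have hg : Tendsto g atTop cofinite := hg₀.comp hσ.tendsto_atTop
  have hgc : Tendsto (fun j => Φ (g j)) atTop (𝓝 c) := hg₀c.comp hσ.tendsto_atTop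
  have hgα (k : Fin N) : Tendsto (fun j => a k (g j)) atTop (𝓝 (α k)) :=
    tendsto_pi_nhds.1 hα k
  have htr {E : Type} [NormedAddCommGroup E] {f : ℓ^∞(Lattice N, E)} (hf : SlowlyOscillating f)
      {b : E} (hb : Tendsto (fun j => f (g j)) atTop (𝓝 b)) (x : Lattice N) :
      Tendsto (fun j => f (x + g j)) atTop (𝓝 b) := by
    have h := ((hf x).comp hg).add hb
    rw [zero_add] at h
    refine h.congr fun j => ?_
    simp [add_comm]
  refine ⟨g, α, fun k => tendsto_nhds_unique (hgα k).norm ((ha1 k).comp hg), hgc, ?_⟩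
  have hbd (f : ℓ^∞(Lattice N, ℂ)) (h : Lattice N) : ‖translate h f‖ ≤ ‖f‖ :=
    lp.norm_le_of_forall_le (norm_nonneg _) fun x => norm_apply_le f _
  have key : StrongStarTendsto (fun j => shift p (-g j) ∘L schrodinger p a Φ ∘L shift p (g j))
      (schrodinger p (fun k => constBounded N (α k)) (constBounded N c)) := by
    simp only [shift_neg_comp_schrodinger_comp_shift]
    unfold schrodinger
    refine (StrongStarTendsto.sum _ fun k => ?_).add ?_
    · refine ((StrongStarTendsto.const _).sub ?_).comp ((StrongStarTendsto.const _).sub ?_)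
      · exact strongStarTendsto_mulOp hp hp' (fun j => hbd _ _) fun x => htr (ha k) (hgα k) x
      · refine strongStarTendsto_mulOp hp hp' (C := ‖a k‖) (fun j => ?_) fun x => ?_
        · rw [norm_star]; exact hbd _ _
        · exact (continuous_star.tendsto _).comp (htr (ha k) (hgα k) x)
    · refine strongStarTendsto_mulOp hp hp' (C := ‖complexify Φ‖)
        (fun j => hbd (complexify Φ) (g j)) fun x => ?_
      exact (Complex.continuous_ofReal.tendsto _).comp (htr hΦ hgc x)
  exact ⟨hg, key.strong, key.strong_adjoint⟩

theorem tendsto_norm_mulOp_indicator_shift (hp : 1 < p) (hp' : p ≠ ∞) {g : ℕ → Lattice N}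
    (hg : Tendsto g atTop cofinite) (F : Finset (Lattice N)) (u : Ell N p) :
    Tendsto (fun j => ‖mulOp p (indicator F) (shift p (g j) u)‖) atTop (𝓝 0) := by
  have h : StrongStarTendsto (fun j => mulOp p (translate (g j) (indicator F))) 0 := by
    refine strongStarTendsto_mulOp_zero hp hp' (C := 1) (fun j => ?_) fun x => ?_
    · refine lp.norm_le_of_forall_le zero_le_one fun x => ?_
      rw [translate_apply, indicator_apply]; split_ifs <;> simp
    · refine tendsto_const_nhds.congr' ?_
      have h : Tendsto (fun j => x + g j) atTop cofinite :=
        (add_right_injective x).tendsto_cofinite.comp hg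
      filter_upwards [h.eventually F.finite_toSet.eventually_cofinite_notMem] with j hj
      rw [translate_apply, indicator_apply, if_neg (by simpa using hj)]
  have h2 := (h.strong u).norm
  rw [zero_apply, norm_zero] at h2
  refine h2.congr fun j => ?_
  rw [← shift_neg_mul_mulOp_mul_shift]
  exact norm_shift_apply _ _

theorem tendsto_dual_shift (hp : 1 < p) (hp' : p ≠ ∞) {g : ℕ → Lattice N}
    (hg : Tendsto g atTop cofinite) (φ : StrongDual ℂ (Ell N p)) (u : Ell N p) :
    Tendsto (fun j => φ (shift p (g j) u)) atTop (𝓝 0) := by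
  rw [tendsto_zero_iff_norm_tendsto_zero]
  refine tendsto_zero_of_forall_le_add (fun _ => norm_nonneg _) fun ε hε => ?_
  obtain ⟨F, hF⟩ := exists_norm_comp_mulOp_one_sub_indicator_le hp hp' φ
    (show 0 < ε / (‖u‖ + 1) by positivity)
  refine ⟨fun j => ‖φ‖ * ‖mulOp p (indicator F) (shift p (g j) u)‖, ?_, fun j => ?_⟩
  · simpa using (tendsto_norm_mulOp_indicator_shift hp hp' hg F u).const_mul ‖φ‖
  · set v := shift p (g j) u with hv
    have h : φ v = φ (mulOp p (indicator F) v) +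
        (φ ∘L mulOp p (constBounded N 1 - indicator F)) v := by
      rw [mulOp_sub, mulOp_constBounded, map_one, ContinuousLinearMap.comp_apply, ← map_add]
      simp
    rw [h]
    refine (norm_add_le _ _).trans (add_le_add (φ.le_opNorm _) ?_)
    refine (ContinuousLinearMap.le_of_opNorm_le _ hF v).trans ?_
    rw [hv, norm_shift_apply, div_mul_eq_mul_div, div_le_iff₀ (by positivity)]
    nlinarith

/-- Finite-rank operators map weakly null sequences to null sequences. -/
theorem tendsto_zero_of_hasFiniteRange {X : Type*} [NormedAddCommGroup X] [NormedSpace ℂ X]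
    {K : X →L[ℂ] X} (hK : K.toLinearMap.HasFiniteRange) {x : ℕ → X}
    (hx : ∀ φ : StrongDual ℂ X, Tendsto (fun j => φ (x j)) atTop (𝓝 0)) :
    Tendsto (fun j => K (x j)) atTop (𝓝 0) := by
  have : FiniteDimensional ℂ K.toLinearMap.range := .of_fg hK
  let e := (Module.finBasis ℂ K.toLinearMap.range).equivFunL
  let K' : X →L[ℂ] K.toLinearMap.range := K.codRestrict _ fun y => ⟨y, rfl⟩
  have h : Tendsto (fun j => e (K' (x j))) atTop (𝓝 0) :=
    tendsto_pi_nhds.2 fun i => hx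
      ((ContinuousLinearMap.proj (R := ℂ) (φ := fun _ => ℂ) i) ∘L e.toContinuousLinearMap ∘L K')
  have h2 := ((continuous_subtype_val.comp e.symm.continuous).tendsto 0).comp h
  simp only [Function.comp_def, map_zero, ContinuousLinearEquiv.symm_apply_apply] at h2
  exact h2

/-- Limit operators of Fredholm operators are bounded below. -/
theorem exists_norm_le_of_isFredholm (hp : 1 < p) (hp' : p ≠ ∞) {A B : Ell N p →L[ℂ] Ell N p}
    {g : ℕ → Lattice N} (hg : Tendsto g atTop cofinite)
    (hB : ∀ u, Tendsto (fun j => shift p (-g j) (A (shift p (g j) u))) atTop (𝓝 (B u)))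
    (hA : A.IsFredholm) : ∃ C : ℝ, ∀ u, ‖u‖ ≤ C * ‖B u‖ := by
  obtain ⟨R, hR, -⟩ := hA.exists_isQuasiInverse
  have hK : (R ∘L A - 1 : Ell N p →L[ℂ] Ell N p).toLinearMap.HasFiniteRange :=
    LinearMap.FiniteRangeSetoid.equiv_iff_hasFiniteRange.1 hR
  refine ⟨‖R‖, fun u => ?_⟩
  have h1 := tendsto_zero_of_hasFiniteRange hK fun φ => tendsto_dual_shift hp hp' hg φ u
  have h2 := ((hB u).norm.const_mul ‖R‖).add h1.norm
  rw [norm_zero, add_zero] at h2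
  refine ge_of_tendsto h2 (Eventually.of_forall fun j => ?_)
  set v := shift p (g j) u with hv
  have h3 : v = R (A v) - (R ∘L A - 1 : Ell N p →L[ℂ] Ell N p) v := by simp
  rw [norm_shift_apply, ← norm_shift_apply (g j) u, ← hv]
  conv_lhs => rw [h3]
  exact (norm_sub_le _ _).trans (add_le_add_left (R.le_opNorm _) _)

section Box

/-- The indicator function of a finite set as an element of `l^p`. -/
def indicatorEll (p : ℝ≥0∞) (F : Finset (Lattice N)) : Ell N p := ∑ i ∈ F, lp.single p i 1

omit [Fact (1 ≤ p)] in
theorem indicatorEll_apply (F : Finset (Lattice N)) (x : Lattice N) :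
    indicatorEll p F x = if x ∈ F then 1 else 0 := by
  rw [indicatorEll, lp.coeFn_sum, Finset.sum_apply]
  simp

omit [Fact (1 ≤ p)] in
theorem norm_indicatorEll_rpow (hp : 0 < p.toReal) (F : Finset (Lattice N)) :
    ‖indicatorEll p F‖ ^ p.toReal = F.card := by
  rw [indicatorEll, lp.norm_sum_single hp (fun _ => (1 : ℂ)) F]
  simp

/-- The cube `[0, L)^N`. -/
def box (N L : ℕ) : Finset (Lattice N) := Fintype.piFinset fun _ => Finset.Ico 0 (L : ℤ)

/-- The slice of the cube `[0, L)^N` at height `m` in direction `k`, moved to height `m`. -/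
def boxFace (N L : ℕ) (k : Fin N) (m : ℤ) : Finset (Lattice N) :=
  Fintype.piFinset (Function.update (fun _ => Finset.Ico 0 (L : ℤ)) k {m})

theorem card_box (L : ℕ) (k : Fin N) (m : ℤ) :
    (box N L).card = L * (boxFace N L k m).card := by
  have h : ∀ i ∈ Finset.univ.erase k,
      (Function.update (fun _ => Finset.Ico 0 (L : ℤ)) k {m} i).card = L := fun i hi => by
    rw [Function.update_of_ne (Finset.ne_of_mem_erase hi)]; simp
  have hl : (box N L).card = L * ∏ i ∈ Finset.univ.erase k, L := by
    rw [box, Fintype.card_piFinset, Finset.mul_prod_erase _ (fun _ => L) (Finset.mem_univ k)]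
    simp
  rw [hl, boxFace, Fintype.card_piFinset, ← Finset.mul_prod_erase _ _ (Finset.mem_univ k),
    Finset.prod_congr rfl h]
  simp

theorem mem_box {L : ℕ} {x : Lattice N} : x ∈ box N L ↔ ∀ i, 0 ≤ x i ∧ x i < L := by
  simp [box]

theorem mem_boxFace {L : ℕ} {k : Fin N} {m : ℤ} {x : Lattice N} :
    x ∈ boxFace N L k m ↔ x k = m ∧ ∀ i ≠ k, 0 ≤ x i ∧ x i < L := by
  rw [boxFace, Fintype.mem_piFinset]
  constructor
  · intro h
    refine ⟨by simpa using h k, fun i hi => by simpa [Function.update_of_ne hi] using h i⟩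
  · rintro ⟨h, h'⟩ i
    by_cases hi : i = k
    · subst hi; simpa using h
    · simpa [Function.update_of_ne hi] using h' i hi

theorem shift_indicatorEll_box_sub (L : ℕ) (k : Fin N) :
    shift p (Pi.single k 1) (indicatorEll p (box N L)) - indicatorEll p (box N L) =
      indicatorEll p (boxFace N L k L) - indicatorEll p (boxFace N L k 0) := by
  ext x
  change indicatorEll p (box N L) (x - Pi.single k 1) - indicatorEll p (box N L) x =
    indicatorEll p (boxFace N L k L) x - indicatorEll p (boxFace N L k 0) x
  simp only [indicatorEll_apply, mem_box, mem_boxFace]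
  have h1 : (∀ i, 0 ≤ (x - Pi.single k 1 : Lattice N) i ∧ (x - Pi.single k 1 : Lattice N) i < L) ↔
      (1 ≤ x k ∧ x k < L + 1) ∧ ∀ i ≠ k, 0 ≤ x i ∧ x i < L := by
    constructor
    · intro h
      refine ⟨?_, fun i hi => by simpa [Pi.single_apply, hi] using h i⟩
      have := h k
      simp only [Pi.sub_apply, Pi.single_eq_same] at this
      omega
    · rintro ⟨h, h'⟩ i
      by_cases hi : i = k
      · subst hi; simp only [Pi.sub_apply, Pi.single_eq_same]; omega
      · simpa [Pi.single_apply, hi] using h' i hi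
  have h2 : (∀ i, 0 ≤ x i ∧ x i < (L : ℤ)) ↔
      (0 ≤ x k ∧ x k < L) ∧ ∀ i ≠ k, 0 ≤ x i ∧ x i < L :=
    ⟨fun h => ⟨h k, fun i _ => h i⟩, fun h i => by
      by_cases hi : i = k
      · exact hi ▸ h.1
      · exact h.2 i hi⟩
  rw [if_congr h1 rfl rfl, if_congr h2 rfl rfl]
  by_cases hQ : ∀ i ≠ k, 0 ≤ x i ∧ x i < (L : ℤ)
  · rw [if_congr (and_iff_left hQ) rfl rfl, if_congr (and_iff_left hQ) rfl rfl,
      if_congr (and_iff_left hQ) rfl rfl, if_congr (and_iff_left hQ) rfl rfl]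
    have hL : (0 : ℤ) ≤ L := Int.natCast_nonneg L
    split_ifs <;> first | omega | simp
  · simp only [hQ, and_false, if_false]

/-- The cubes form a Følner sequence. -/
theorem exists_norm_shift_sub_le (hp' : p ≠ ∞) {ε : ℝ} (hε : 0 < ε) :
    ∃ v : Ell N p, v ≠ 0 ∧ ∀ k, ‖shift p (Pi.single k 1) v - v‖ ≤ ε * ‖v‖ := by
  have hP : 0 < p.toReal := ENNReal.toReal_pos (zero_lt_one.trans_le Fact.out).ne' hp'
  obtain ⟨L, hL⟩ := exists_nat_ge ((2 / ε) ^ p.toReal + 1)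
  have hL1 : (0 : ℝ) < L := by have := Real.rpow_nonneg (div_pos two_pos hε).le p.toReal; linarith
  have hface (k : Fin N) (m : ℤ) :
      ‖indicatorEll p (boxFace N L k m)‖ ≤ ε / 2 * ‖indicatorEll p (box N L)‖ := by
    rw [← Real.rpow_le_rpow_iff (norm_nonneg _) (by positivity) hP,
      Real.mul_rpow (by positivity) (norm_nonneg _), norm_indicatorEll_rpow hP,
      norm_indicatorEll_rpow hP, card_box L k m, Nat.cast_mul, ← mul_assoc]
    refine le_mul_of_one_le_left (Nat.cast_nonneg _) ?_
    have h : (ε / 2) ^ p.toReal * (2 / ε) ^ p.toReal = 1 := by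
      rw [← Real.mul_rpow (by positivity) (by positivity), div_mul_div_cancel₀' hε.ne',
        div_self two_ne_zero, Real.one_rpow]
    rw [← h]
    exact mul_le_mul_of_nonneg_left (by linarith) (by positivity)
  refine ⟨indicatorEll p (box N L), fun h => ?_, fun k => ?_⟩
  · have h0 : indicatorEll p (box N L) 0 = 1 := by
      exact (indicatorEll_apply _ _).trans
        (if_pos (mem_box.2 fun i => ⟨le_rfl, by exact_mod_cast hL1⟩))
    rw [h] at h0
    exact zero_ne_one h0
  · rw [shift_indicatorEll_box_sub]
    refine (norm_sub_le _ _).trans ((add_le_add (hface k L) (hface k 0)).trans_eq ?_)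
    ring

end Box

theorem norm_shift_neg_sub (g : Lattice N) (v : Ell N p) :
    ‖shift p (-g) v - v‖ = ‖shift p g v - v‖ := by
  have h : shift p g (shift p (-g) v - v) = -(shift p g v - v) := by
    rw [map_sub, ← mul_apply_eq_comp, shift_mul_shift, add_neg_cancel, shift_zero]
    simp
  rw [← norm_shift_apply g, h, norm_neg]

/-- The plane wave `x ↦ ∏ₖ wₖ ^ xₖ` with unimodular `wₖ`. -/
def planeWave (w : Fin N → ℂ) (hw : ∀ k, ‖w k‖ = 1) : ℓ^∞(Lattice N, ℂ) :=
  ofBounded (fun x => ∏ k, w k ^ x k) 1 fun x => by simp [norm_prod, hw]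

theorem planeWave_add_single (w : Fin N → ℂ) (hw : ∀ k, ‖w k‖ = 1) (x : Lattice N) (k : Fin N)
    (m : ℤ) : planeWave w hw (x + Pi.single k m) = planeWave w hw x * w k ^ m := by
  have h0 (k : Fin N) : w k ≠ 0 := norm_pos_iff.1 (by rw [hw]; exact one_pos)
  simp only [planeWave, ofBounded_apply, Pi.add_apply, zpow_add₀ (h0 _), Finset.prod_mul_distrib]
  congr 1
  rw [Finset.prod_eq_single k (fun i _ hi => by simp [hi]) (by simp)]
  simp

theorem norm_planeWave_apply (w : Fin N → ℂ) (hw : ∀ k, ‖w k‖ = 1) (x : Lattice N) :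
    ‖planeWave w hw x‖ = 1 := by
  simp [planeWave, norm_prod, hw]

theorem norm_mulOp_planeWave (w : Fin N → ℂ) (hw : ∀ k, ‖w k‖ = 1) (v : Ell N p) :
    ‖mulOp p (planeWave w hw) v‖ = ‖v‖ := by
  refine le_antisymm (norm_mulOp_apply_le _ (fun x => (norm_planeWave_apply w hw x).le) v) ?_
  have h : mulOp p (star (planeWave w hw)) (mulOp p (planeWave w hw) v) = v := by
    ext x
    rw [mulOp_apply, mulOp_apply, ← mul_assoc]
    change conj (planeWave w hw x) * planeWave w hw x * v x = v x
    rw [Complex.conj_mul', norm_planeWave_apply]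
    simp
  conv_lhs => rw [← h]
  refine norm_mulOp_apply_le _ (fun x => ?_) _
  change ‖conj (planeWave w hw x)‖ ≤ 1
  rw [RCLike.norm_conj, norm_planeWave_apply]

/-- Conjugating a constant-coefficient Schrödinger operator by a plane wave. -/
theorem schrodinger_const_sub_mulOp_planeWave {α : Fin N → ℂ} (hα : ∀ k, ‖α k‖ = 1) {ζ : ℂ}
    (hζ : ‖ζ‖ = 1) {c : ℝ} {z : ℂ} (hz : z = N * (2 - ζ - conj ζ) + c)
    (hw : ∀ k, ‖conj (α k) * ζ‖ = 1) (v : Ell N p) :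
    (schrodinger p (fun k => constBounded N (α k)) (constBounded N c)
        - z • ContinuousLinearMap.id ℂ (Ell N p)) (mulOp p (planeWave _ hw) v) =
      mulOp p (planeWave _ hw) (∑ k, (-(conj ζ) • (shift p (Pi.single k 1) v - v) +
        (-ζ) • (shift p (-Pi.single k 1) v - v))) := by
  ext x
  have hζ' : ζ * conj ζ = 1 := by rw [Complex.mul_conj', hζ]; simp
  have hα' (k : Fin N) : α k * conj (α k) = 1 := by rw [Complex.mul_conj', hα]; simp
  have hinv (k : Fin N) : (conj (α k) * ζ)⁻¹ = α k * conj ζ := by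
    rw [Complex.inv_eq_conj (hw k), map_mul, Complex.conj_conj]
  have hR : (∑ k, (-(conj ζ) • (shift p (Pi.single k 1) v - v) +
        (-ζ) • (shift p (-Pi.single k 1) v - v)) : Ell N p) x =
      ∑ k, (-(conj ζ) * (v (x - Pi.single k 1) - v x) + -ζ * (v (x + Pi.single k 1) - v x)) := by
    rw [lp.coeFn_sum, Finset.sum_apply]
    refine Finset.sum_congr rfl fun k _ => ?_
    rw [← sub_neg_eq_add x]
    rfl
  rw [mulOp_apply, hR]
  change schrodinger p (fun k => constBounded N (α k)) (constBounded N c)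
    (mulOp p (planeWave _ hw) v) x - z * mulOp p (planeWave _ hw) v x = _
  rw [schrodinger_apply]
  have h1 (k : Fin N) : planeWave _ hw (x + Pi.single k 1) =
      planeWave _ hw x * (conj (α k) * ζ) := by rw [planeWave_add_single, zpow_one]
  have h2 (k : Fin N) : planeWave _ hw (x - Pi.single k 1) =
      planeWave _ hw x * (α k * conj ζ) := by
    rw [sub_eq_add_neg, ← Pi.single_neg, planeWave_add_single, zpow_neg_one, hinv]
  simp only [mulOp_apply, constBounded_apply, h1, h2]
  have h3 : (∑ k, (-(conj ζ) * (v (x - Pi.single k 1) - v x) +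
      -ζ * (v (x + Pi.single k 1) - v x))) =
      (∑ k, (2 * v x - conj ζ * v (x - Pi.single k 1) - ζ * v (x + Pi.single k 1)))
        - N * (2 - ζ - conj ζ) * v x := by
    rw [eq_sub_iff_add_eq, show (N : ℂ) * (2 - ζ - conj ζ) * v x =
      ∑ _k : Fin N, (2 - ζ - conj ζ) * v x by simp [mul_assoc], ← Finset.sum_add_distrib]
    exact Finset.sum_congr rfl fun k _ => by ring
  have h4 : (∑ k, (planeWave _ hw x * v x - conj (α k) * (planeWave _ hw x * (α k * conj ζ) *
      v (x - Pi.single k 1)) - α k * (planeWave _ hw x * (conj (α k) * ζ) * v (x + Pi.single k 1) -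
        conj (α k) * (planeWave _ hw x * v x)))) = planeWave _ hw x *
      ∑ k, (2 * v x - conj ζ * v (x - Pi.single k 1) - ζ * v (x + Pi.single k 1)) := by
    rw [Finset.mul_sum]
    refine Finset.sum_congr rfl fun k _ => ?_
    linear_combination (planeWave _ hw x * (v x - conj ζ * v (x - Pi.single k 1) -
      ζ * v (x + Pi.single k 1))) * hα' k
  rw [h3, hz]
  refine (congrArg (fun t => t + _ - _) h4).trans ?_
  ring

theorem exists_norm_eq_one_and_symbol_eq (hN : 1 ≤ N) {s : ℝ} (hs : s ∈ Set.Icc 0 (4 * (N : ℝ))) :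
    ∃ ζ : ℂ, ‖ζ‖ = 1 ∧ N * (2 - ζ - conj ζ) = (s : ℂ) := by
  have hN0 : (0 : ℝ) < N := by exact_mod_cast hN
  refine ⟨Complex.exp (Real.arccos (1 - s / (2 * N)) * Complex.I), Complex.norm_exp_ofReal_mul_I _,
    ?_⟩
  set ζ := Complex.exp (Real.arccos (1 - s / (2 * N)) * Complex.I) with hζ
  have h : ζ + conj ζ = ((2 * (1 - s / (2 * N)) : ℝ) : ℂ) := by
    rw [Complex.add_conj, hζ, Complex.exp_ofReal_mul_I_re, Real.cos_arccos]
    · have : s / (2 * N) ≤ 2 := by rw [div_le_iff₀ (by positivity)]; linarith [hs.2]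
      linarith
    · have : 0 ≤ s / (2 * N) := div_nonneg hs.1 (by positivity)
      linarith
  rw [sub_sub, h]
  have hN' : (N : ℂ) ≠ 0 := by exact_mod_cast hN0.ne'
  push_cast
  field_simp
  ring

theorem mem_essSpectrum_schrodinger (hN : 1 ≤ N) (hp : 1 < p) (hp' : p ≠ ∞)
    (a : Fin N → ℓ^∞(Lattice N, ℂ)) (Φ : ℓ^∞(Lattice N, ℝ))
    (ha : ∀ k, SlowlyOscillating (a k)) (ha1 : ∀ k, Tendsto (fun x => ‖a k x‖) cofinite (𝓝 1))
    (hΦ : SlowlyOscillating Φ) {c : ℝ} (hc : MapClusterPt c cofinite Φ) {z : ℂ}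
    (hz : z ∈ Complex.ofReal '' Set.Icc c (c + 4 * N)) : z ∈ essSpectrum (schrodinger p a Φ) := by
  intro hF
  obtain ⟨g, α, hα, -, hlim⟩ := exists_isLimitOperator hp hp' a Φ ha ha1 hΦ hc
  obtain ⟨r, hr, rfl⟩ := hz
  obtain ⟨ζ, hζ, hζs⟩ := exists_norm_eq_one_and_symbol_eq hN
    (show r - c ∈ Set.Icc 0 (4 * (N : ℝ)) from ⟨by linarith [hr.1], by linarith [hr.2]⟩)
  obtain ⟨C, hC⟩ := exists_norm_le_of_isFredholm hp hp' (g := g)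
    (B := schrodinger p (fun k => constBounded N (α k)) (constBounded N c)
        - (r : ℂ) • ContinuousLinearMap.id ℂ (Ell N p)) hlim.tendsto_infty (fun u => by
      refine ((hlim.strong u).sub_const ((r : ℂ) • u)).congr fun j => ?_
      have h : shift p (-g j) (shift p (g j) u) = u := by
        rw [← mul_apply_eq_comp, shift_mul_shift, neg_add_cancel, shift_zero]; rfl
      have h' : shift p (-g j) ((schrodinger p a Φ - (r : ℂ) • ContinuousLinearMap.id ℂ (Ell N p))
          (shift p (g j) u)) = shift p (-g j) (schrodinger p a Φ (shift p (g j) u)) -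
            (r : ℂ) • shift p (-g j) (shift p (g j) u) := by
        rw [← map_smul, ← map_sub]; rfl
      rw [h', h]; rfl) hF
  have hw (k : Fin N) : ‖conj (α k) * ζ‖ = 1 := by simp [hα, hζ]
  obtain ⟨v, hv0, hv⟩ := exists_norm_shift_sub_le (N := N) hp'
    (show 0 < 1 / (2 * N * (|C| + 1)) by positivity)
  have hv1 : 0 < ‖v‖ := norm_pos_iff.2 hv0
  have h1 := hC (mulOp p (planeWave _ hw) v)
  rw [schrodinger_const_sub_mulOp_planeWave hα hζ (by rw [hζs]; push_cast; ring) hw,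
    norm_mulOp_planeWave, norm_mulOp_planeWave] at h1
  have h2 : ‖∑ k, (-(conj ζ) • (shift p (Pi.single k 1) v - v) +
        (-ζ) • (shift p (-Pi.single k 1) v - v))‖ ≤
      ∑ _k : Fin N, 2 * (1 / (2 * N * (|C| + 1)) * ‖v‖) := by
    refine norm_sum_le_of_le _ fun k _ => (norm_add_le _ _).trans ?_
    rw [norm_smul, norm_smul, norm_neg, norm_neg, RCLike.norm_conj, hζ, one_mul, one_mul,
      norm_shift_neg_sub]
    linarith [hv k]
  have hN0 : (0 : ℝ) < N := by exact_mod_cast hN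
  have h3 : ∑ _k : Fin N, 2 * (1 / (2 * N * (|C| + 1)) * ‖v‖) = ‖v‖ / (|C| + 1) := by
    simp only [Finset.sum_const, Finset.card_univ, Fintype.card_fin, nsmul_eq_mul]
    field_simp
  rw [h3] at h2
  have h4 : ‖v‖ ≤ |C| * (‖v‖ / (|C| + 1)) := h1.trans
    (mul_le_mul (le_abs_self C) h2 (norm_nonneg _) (abs_nonneg C))
  rw [mul_div_assoc', le_div_iff₀ (by positivity)] at h4
  nlinarith

end DiscreteSchrodinger

section ClusterValues

variable {X : Type*} {l : Filter X} {f : X → ℝ}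

/-- If the values of a bounded function cannot jump across a gap along a filter, then its cluster
values fill the interval between its lower and its upper limit. -/
theorem mapClusterPt_iff_mem_Icc_liminf_limsup [l.NeBot] {C : ℝ} (hC : ∀ x, |f x| ≤ C)
    (h : ∀ t ε, 0 < ε → (∀ᶠ x in l, ε ≤ |f x - t|) →
      (∀ᶠ x in l, f x < t) ∨ ∀ᶠ x in l, t < f x) (c : ℝ) :
    MapClusterPt c l f ↔ c ∈ Set.Icc (liminf f l) (limsup f l) := by
  have hle : l.IsBoundedUnder (· ≤ ·) f := isBoundedUnder_of ⟨C, fun x => (abs_le.1 (hC x)).2⟩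
  have hge : l.IsBoundedUnder (· ≥ ·) f := isBoundedUnder_of ⟨-C, fun x => (abs_le.1 (hC x)).1⟩
  constructor
  · intro hc
    rw [mapClusterPt_iff_frequently] at hc
    constructor
    · by_contra! hlt
      obtain ⟨m, hm, hm'⟩ := exists_between hlt
      exact hc _ (Iio_mem_nhds hm)
        ((eventually_lt_of_lt_liminf hm' hge).mono fun x hx hx' => lt_asymm hx hx')
    · by_contra! hlt
      obtain ⟨m, hm, hm'⟩ := exists_between hlt
      exact hc _ (Ioi_mem_nhds hm')
        ((eventually_lt_of_limsup_lt hm hle).mono fun x hx hx' => lt_asymm hx hx')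
  · rintro ⟨h1, h2⟩
    rw [mapClusterPt_iff_frequently]
    intro s hs
    obtain ⟨ε, hε, hεs⟩ := Metric.mem_nhds_iff.1 hs
    by_contra hnot
    have hev : ∀ᶠ x in l, ε ≤ |f x - c| := by
      filter_upwards [not_frequently.1 hnot] with x hx
      by_contra! hlt
      exact hx (hεs (by rwa [Metric.mem_ball, Real.dist_eq]))
    rcases h c ε hε hev with h | h
    · have h3 : limsup f l ≤ c - ε := limsup_le_of_le hge.isCoboundedUnder_le (by
        filter_upwards [h, hev] with x hx hx'
        rw [abs_of_neg (by linarith)] at hx'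
        linarith)
      linarith
    · have h3 : c + ε ≤ liminf f l := le_liminf_of_le hle.isCoboundedUnder_ge (by
        filter_upwards [h, hev] with x hx hx'
        rw [abs_of_pos (by linarith)] at hx'
        linarith)
      linarith

theorem lt_iff_lt_of_abs_sub_lt {a b t ε : ℝ} (hab : |b - a| < ε) (ha : ε ≤ |a - t|)
    (hb : ε ≤ |b - t|) : a < t ↔ b < t := by
  rw [abs_lt] at hab
  rw [le_abs] at ha hb
  constructor <;> intro h <;> rcases ha with ha | ha <;> rcases hb with hb | hb <;> linarith

theorem eventually_lt_or_lt_of_forall_iff {t ε : ℝ} {s : Set X} (hs : s ∈ l) (hε : 0 < ε)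
    (hev : ∀ x ∈ s, ε ≤ |f x - t|) (h : ∀ x ∈ s, ∀ y ∈ s, f x < t → f y < t) :
    (∀ᶠ x in l, f x < t) ∨ ∀ᶠ x in l, t < f x := by
  by_cases hx : ∃ x ∈ s, f x < t
  · obtain ⟨x, hxs, hx⟩ := hx
    exact Or.inl (mem_of_superset hs fun y hy => h x hxs y hy hx)
  · push Not at hx
    refine Or.inr (mem_of_superset hs fun y hy => lt_of_le_of_ne (hx y hy) fun h => ?_)
    have := hev y hy
    rw [h, sub_self, abs_zero] at this
    linarith

theorem eventually_lt_or_lt_atTop {f : ℤ → ℝ} (hf : Tendsto (fun n => f (n + 1) - f n) atTop (𝓝 0))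
    (t ε : ℝ) (hε : 0 < ε) (hev : ∀ᶠ n in atTop, ε ≤ |f n - t|) :
    (∀ᶠ n in atTop, f n < t) ∨ ∀ᶠ n in atTop, t < f n := by
  have hf' := (Metric.tendsto_nhds.1 hf) ε hε
  simp only [Real.dist_eq, sub_zero] at hf'
  obtain ⟨m, hm⟩ := eventually_atTop.1 (hev.and hf')
  refine eventually_lt_or_lt_of_forall_iff (Ici_mem_atTop m) hε (fun n hn => (hm n hn).1) ?_
  have key : ∀ n, m ≤ n → (f m < t ↔ f n < t) := fun n hn => by
    induction n, hn using Int.leInduction with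
    | base => rfl
    | succ n hn ih =>
      exact ih.trans (lt_iff_lt_of_abs_sub_lt (hm n hn).2 (hm n hn).1 (hm _ (by omega)).1)
  exact fun x hx y hy h => (key y hy).1 ((key x hx).2 h)

theorem eventually_lt_or_lt_atBot {f : ℤ → ℝ} (hf : Tendsto (fun n => f (n + 1) - f n) atBot (𝓝 0))
    (t ε : ℝ) (hε : 0 < ε) (hev : ∀ᶠ n in atBot, ε ≤ |f n - t|) :
    (∀ᶠ n in atBot, f n < t) ∨ ∀ᶠ n in atBot, t < f n := by
  have hf' := (Metric.tendsto_nhds.1 hf) ε hε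
  simp only [Real.dist_eq, sub_zero] at hf'
  obtain ⟨m, hm⟩ := eventually_atBot.1 (hev.and hf')
  refine eventually_lt_or_lt_of_forall_iff (Iic_mem_atBot m) hε (fun n hn => (hm n hn).1) ?_
  have key : ∀ n, n ≤ m → (f m < t ↔ f n < t) := fun n hn => by
    induction n, hn using Int.leInductionDown with
    | base => rfl
    | pred n hn ih =>
      have h := (hm (n - 1) (by omega)).2
      rw [sub_add_cancel] at h
      exact ih.trans (lt_iff_lt_of_abs_sub_lt h (hm (n - 1) (by omega)).1 (hm n hn).1).symm
  exact fun x hx y hy h => (key y hy).1 ((key x hx).2 h)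

theorem exists_Icc_union_iff {m M L z : ℝ} (hmM : m ≤ M) (hL : 0 ≤ L) :
    (∃ c ∈ Set.Icc m M, z ∈ Set.Icc c (c + L)) ↔ z ∈ Set.Icc m (M + L) := by
  constructor
  · rintro ⟨c, hc, hz⟩
    exact ⟨hc.1.trans hz.1, hz.2.trans (by linarith [hc.2])⟩
  · intro hz
    refine ⟨min z M, ⟨le_min hz.1 hmM, min_le_right _ _⟩, min_le_left _ _, ?_⟩
    rcases le_total z M with h | h
    · rw [min_eq_left h]; linarith
    · rw [min_eq_right h]; exact hz.2

end ClusterValues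

namespace DiscreteSchrodinger

variable {N : ℕ}

/-- The complement of the cube `[-R, R]^N`. -/
def outside (N : ℕ) (R : ℤ) : Set (Lattice N) := {x | ∃ i, R < |x i|}

theorem outside_mem_cofinite (R : ℤ) : outside N R ∈ (cofinite : Filter (Lattice N)) := by
  rw [mem_cofinite]
  refine (Set.finite_Icc (fun _ : Fin N => -R) (fun _ => R)).subset fun x hx => ?_
  have h : ∀ i, |x i| ≤ R := by simpa [outside] using hx
  exact ⟨fun i => (abs_le.1 (h i)).1, fun i => (abs_le.1 (h i)).2⟩

theorem exists_forall_outside {P : Lattice N → Prop} (h : ∀ᶠ x in cofinite, P x) :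
    ∃ R : ℤ, 0 ≤ R ∧ ∀ x ∈ outside N R, P x := by
  rw [eventually_cofinite] at h
  refine ⟨∑ x ∈ h.toFinset, ∑ i, |x i|,
    Finset.sum_nonneg fun _ _ => Finset.sum_nonneg fun _ _ => abs_nonneg _, fun x hx => ?_⟩
  by_contra hP
  obtain ⟨i, hi⟩ := hx
  have h1 : |x i| ≤ ∑ i, |x i| :=
    Finset.single_le_sum (f := fun i => |x i|) (fun _ _ => abs_nonneg _) (Finset.mem_univ i)
  have h2 : ∑ i, |x i| ≤ ∑ x ∈ h.toFinset, ∑ i, |x i| :=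
    Finset.single_le_sum (f := fun x : Lattice N => ∑ i, |x i|)
      (fun _ _ => Finset.sum_nonneg fun _ _ => abs_nonneg _) (h.mem_toFinset.2 hP)
  omega

/-- In dimension at least two, the complement of a cube is connected by unit steps. -/
theorem iff_of_forall_step_iff (hN : 2 ≤ N) {R : ℤ} (hR : 0 ≤ R) {Q : Lattice N → Prop}
    (hQ : ∀ x k, x ∈ outside N R → x + Pi.single k 1 ∈ outside N R →
      (Q x ↔ Q (x + Pi.single k 1))) {x : Lattice N} (hx : x ∈ outside N R) :
    Q x ↔ Q (fun _ => R + 1) := by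
  have hline (x : Lattice N) (i j : Fin N) (hij : j ≠ i) (hi : R < |x i|) (n : ℤ) :
      Q (Function.update x j n) ↔ Q (Function.update x j 0) := by
    have hout (n : ℤ) : Function.update x j n ∈ outside N R :=
      ⟨i, by rwa [Function.update_of_ne hij.symm]⟩
    have hstep (n : ℤ) : Q (Function.update x j n) ↔ Q (Function.update x j (n + 1)) := by
      have h : Function.update x j (n + 1) = Function.update x j n + Pi.single j 1 := by
        ext l
        by_cases hl : l = j
        · subst hl; simp
        · simp [hl]
      rw [h]
      exact hQ _ _ (hout n) (h ▸ hout (n + 1))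
    induction n using Int.induction_on with
    | zero => rfl
    | succ n ih => exact (hstep _).symm.trans ih
    | pred n ih =>
      refine Iff.trans ?_ ih
      have := hstep (-(n : ℤ) - 1)
      rwa [sub_add_cancel] at this
  have hline' (x : Lattice N) (i j : Fin N) (hij : j ≠ i) (hi : R < |x i|) (n : ℤ) :
      Q x ↔ Q (Function.update x j n) := by
    rw [hline x i j hij hi n, ← hline x i j hij hi (x j), Function.update_eq_self]
  obtain ⟨i, hi⟩ := hx
  have : Nontrivial (Fin N) := Fin.nontrivial_iff_two_le.2 hN
  obtain ⟨j, hij⟩ := exists_ne i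
  rw [hline' x i j hij hi (R + 1)]
  set y := Function.update x j (R + 1) with hy
  have hyj : y j = R + 1 := by simp [hy]
  have key (s : Finset (Fin N)) : Q y ↔ Q (fun l => if l ∈ s then R + 1 else y l) := by
    induction s using Finset.induction_on with
    | empty => simp
    | insert l s hl ih =>
      rw [ih]
      have hupd : (fun m => if m ∈ insert l s then R + 1 else y m) =
          Function.update (fun m => if m ∈ s then R + 1 else y m) l (R + 1) := by
        ext m
        by_cases hm : m = l
        · subst hm; simp
        · simp [hm]
      have hzj : (if j ∈ s then R + 1 else y j) = R + 1 := by rw [hyj, ite_self]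
      rw [hupd]
      by_cases hlj : l = j
      · subst hlj
        rw [Function.update_eq_self_iff.2]
        exact hzj.symm
      · refine hline' _ j l hlj ?_ _
        rw [hzj, abs_of_pos (by omega)]
        omega
  rw [key Finset.univ]
  simp

theorem eventually_lt_or_lt_cofinite (hN : 2 ≤ N) {Φ : ℓ^∞(Lattice N, ℝ)}
    (hΦ : SlowlyOscillating Φ) (t ε : ℝ) (hε : 0 < ε)
    (hev : ∀ᶠ x in cofinite, ε ≤ |Φ x - t|) :
    (∀ᶠ x in cofinite, Φ x < t) ∨ ∀ᶠ x in cofinite, t < Φ x := by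
  have hstep : ∀ᶠ x in cofinite, ∀ k : Fin N, |Φ (x + Pi.single k 1) - Φ x| < ε := by
    rw [eventually_all]
    intro k
    have h := (Metric.tendsto_nhds.1 (hΦ (Pi.single k 1))) ε hε
    simpa only [Real.dist_eq, sub_zero] using h
  obtain ⟨R, hR, h⟩ := exists_forall_outside (hev.and hstep)
  refine eventually_lt_or_lt_of_forall_iff (outside_mem_cofinite R) hε (fun x hx => (h x hx).1) ?_
  have key {x : Lattice N} (hx : x ∈ outside N R) :=
    iff_of_forall_step_iff hN hR (Q := fun x => Φ x < t) (fun x k hx hx' =>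
      lt_iff_lt_of_abs_sub_lt ((h x hx).2 k) (h x hx).1 (h _ hx').1) hx
  exact fun x hx y hy hlt => (key hy).2 ((key hx).1 hlt)

theorem tendsto_const_fin_one : Tendsto (fun (n : ℤ) (_ : Fin 1) => n) cofinite cofinite :=
  Function.Injective.tendsto_cofinite fun _ _ h => congrFun h 0

theorem mapClusterPt_cofinite_iff_fin_one {Φ : Lattice 1 → ℝ} {c : ℝ} :
    MapClusterPt c cofinite Φ ↔
      MapClusterPt c atBot (fun n : ℤ => Φ fun _ => n) ∨
        MapClusterPt c atTop (fun n : ℤ => Φ fun _ => n) := by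
  have h : (cofinite : Filter (Lattice 1)) = map (fun (n : ℤ) (_ : Fin 1) => n) (atBot ⊔ atTop) := by
    rw [← Int.cofinite_eq]
    have hinj : Function.Injective fun (n : ℤ) (_ : Fin 1) => n := fun _ _ h => congrFun h 0
    rw [← hinj.comap_cofinite_eq, map_comap_of_surjective]
    exact fun x => ⟨x 0, funext fun i => congrArg x (Subsingleton.elim 0 i)⟩
  rw [h, MapClusterPt, map_map, Filter.map_sup, ClusterPt, inf_sup_left, sup_neBot]
  rfl

theorem mem_essSpectrum_schrodinger_iff {p : ℝ≥0∞} [Fact (1 ≤ p)] (hN : 1 ≤ N)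
    (hp : 1 < p) (hp' : p ≠ ∞)
    (a : Fin N → ℓ^∞(Lattice N, ℂ)) (Φ : ℓ^∞(Lattice N, ℝ))
    (ha : ∀ k, SlowlyOscillating (a k)) (ha1 : ∀ k, Tendsto (fun x => ‖a k x‖) cofinite (𝓝 1))
    (hΦ : SlowlyOscillating Φ) (z : ℂ) :
    z ∈ essSpectrum (schrodinger p a Φ) ↔
      ∃ c : ℝ, MapClusterPt c cofinite Φ ∧ z ∈ Complex.ofReal '' Set.Icc c (c + 4 * N) :=
  ⟨essSpectrum_schrodinger_subset a Φ ha ha1 hΦ, fun ⟨_, hc, hz⟩ =>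
    mem_essSpectrum_schrodinger hN hp hp' a Φ ha ha1 hΦ hc hz⟩

/-- Intervals over the cluster values of a function without gaps fill one interval. -/
theorem exists_mapClusterPt_and_mem_iff {X : Type*} {l : Filter X} [l.NeBot] {f : X → ℝ} {C : ℝ}
    (hC : ∀ x, |f x| ≤ C)
    (h : ∀ t ε, 0 < ε → (∀ᶠ x in l, ε ≤ |f x - t|) →
      (∀ᶠ x in l, f x < t) ∨ ∀ᶠ x in l, t < f x) {L : ℝ} (hL : 0 ≤ L) (z : ℂ) :
    (∃ c : ℝ, MapClusterPt c l f ∧ z ∈ Complex.ofReal '' Set.Icc c (c + L)) ↔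
      z ∈ Complex.ofReal '' Set.Icc (liminf f l) (limsup f l + L) := by
  have hle : liminf f l ≤ limsup f l := liminf_le_limsup
    (isBoundedUnder_of ⟨C, fun x => (abs_le.1 (hC x)).2⟩)
    (isBoundedUnder_of ⟨-C, fun x => (abs_le.1 (hC x)).1⟩)
  simp only [mapClusterPt_iff_mem_Icc_liminf_limsup hC h]
  constructor
  · rintro ⟨c, hc, r, hr, rfl⟩
    exact ⟨r, (exists_Icc_union_iff hle hL).1 ⟨c, hc, hr⟩, rfl⟩
  · rintro ⟨r, hr, rfl⟩
    obtain ⟨c, hc, hr⟩ := (exists_Icc_union_iff hle hL).2 hr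
    exact ⟨c, hc, r, hr, rfl⟩

end DiscreteSchrodinger

end

theorem mainTheorem5 (N : ℕ) (hN : 1 ≤ N) (p : ℝ≥0∞) [Fact (1 ≤ p)] (hp : 1 < p) (hp' : p ≠ ∞)
    (a : Fin N → ℓ^∞(DiscreteSchrodinger.Lattice N, ℂ))
    (Φ : ℓ^∞(DiscreteSchrodinger.Lattice N, ℝ))
    (ha : ∀ k, DiscreteSchrodinger.SlowlyOscillating (a k))
    (ha1 : ∀ k, Tendsto (fun x => ‖a k x‖) cofinite (𝓝 1))
    (hΦ : DiscreteSchrodinger.SlowlyOscillating Φ) :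
    -- the essential spectrum is the union of the intervals `[Φ^g, Φ^g + 4N]` over all
    -- sequences `g` for which the limit operator exists
    (DiscreteSchrodinger.essSpectrum (DiscreteSchrodinger.schrodinger p a Φ) =
      {z : ℂ | ∃ (g : ℕ → DiscreteSchrodinger.Lattice N)
        (B : DiscreteSchrodinger.Ell N p →L[ℂ] DiscreteSchrodinger.Ell N p) (c : ℝ),
        DiscreteSchrodinger.IsLimitOperator (DiscreteSchrodinger.schrodinger p a Φ) g B ∧
        Tendsto (fun j => Φ (g j)) atTop (𝓝 c) ∧
        z ∈ Complex.ofReal '' Set.Icc c (c + 4 * N)}) ∧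
    -- the closed form in dimension at least two
    (2 ≤ N → DiscreteSchrodinger.essSpectrum (DiscreteSchrodinger.schrodinger p a Φ) =
      Complex.ofReal '' Set.Icc (liminf (fun x => Φ x) cofinite)
        (limsup (fun x => Φ x) cofinite + 4 * N)) ∧
    -- the closed form in dimension one, where `ℤ` has two ends
    (N = 1 → DiscreteSchrodinger.essSpectrum (DiscreteSchrodinger.schrodinger p a Φ) =
      Complex.ofReal ''
        (Set.Icc (liminf (fun n : ℤ => Φ (fun _ => n)) atBot)
            (limsup (fun n : ℤ => Φ (fun _ => n)) atBot + 4) ∪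
          Set.Icc (liminf (fun n : ℤ => Φ (fun _ => n)) atTop)
            (limsup (fun n : ℤ => Φ (fun _ => n)) atTop + 4))) ∧
    -- independence of the magnetic potential
    (∀ b : Fin N → ℓ^∞(DiscreteSchrodinger.Lattice N, ℂ),
      (∀ k, DiscreteSchrodinger.SlowlyOscillating (b k)) →
      (∀ k, Tendsto (fun x => ‖b k x‖) cofinite (𝓝 1)) →
      DiscreteSchrodinger.essSpectrum (DiscreteSchrodinger.schrodinger p b Φ) =
        DiscreteSchrodinger.essSpectrum (DiscreteSchrodinger.schrodinger p a Φ)) := by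
  have key := DiscreteSchrodinger.mem_essSpectrum_schrodinger_iff hN hp hp' a Φ ha ha1 hΦ
  have hC (x : DiscreteSchrodinger.Lattice N) : |Φ x| ≤ ‖Φ‖ := DiscreteSchrodinger.norm_apply_le Φ x
  refine ⟨?_, fun hN2 => ?_, fun hN1 => ?_, fun b hb hb1 => ?_⟩
  · ext z
    rw [key z]
    constructor
    · rintro ⟨c, hc, hz⟩
      obtain ⟨g, α, -, hgc, hg⟩ :=
        DiscreteSchrodinger.exists_isLimitOperator hp hp' a Φ ha ha1 hΦ hc
      exact ⟨g, _, c, hg, hgc, hz⟩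
    · rintro ⟨g, B, c, hg, hgc, hz⟩
      exact ⟨c, hgc.mapClusterPt.of_comp hg.tendsto_infty, hz⟩
  · have : Nonempty (Fin N) := ⟨⟨0, hN⟩⟩
    ext z
    rw [key z]
    exact DiscreteSchrodinger.exists_mapClusterPt_and_mem_iff hC
      (DiscreteSchrodinger.eventually_lt_or_lt_cofinite hN2 hΦ) (by positivity) z
  · subst hN1
    have hstep : Tendsto (fun n : ℤ => Φ (fun _ => n + 1) - Φ (fun _ => n)) cofinite (𝓝 0) :=
      (hΦ (fun _ => 1)).comp DiscreteSchrodinger.tendsto_const_fin_one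
    rw [Int.cofinite_eq, tendsto_sup] at hstep
    have hbot := DiscreteSchrodinger.exists_mapClusterPt_and_mem_iff
      (f := fun n : ℤ => Φ fun _ => n) (fun n => hC _)
      (eventually_lt_or_lt_atBot hstep.1) zero_le_four
    have htop := DiscreteSchrodinger.exists_mapClusterPt_and_mem_iff
      (f := fun n : ℤ => Φ fun _ => n) (fun n => hC _)
      (eventually_lt_or_lt_atTop hstep.2) zero_le_four
    ext z
    rw [key z, Set.image_union, Set.mem_union, ← hbot z, ← htop z, ← exists_or]
    simp only [DiscreteSchrodinger.mapClusterPt_cofinite_iff_fin_one, or_and_right, Nat.cast_one,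
      mul_one]
  · ext z
    rw [key z, DiscreteSchrodinger.mem_essSpectrum_schrodinger_iff hN hp hp' b Φ hb hb1 hΦ z]
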